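/- Let $p(x)=a_0+a_1x+\dots+a_dx^d$ be a polynomial of degree $d\ge 1$ all of whose coefficients $a_0,\dots,a_d$ are positive integers. For integers $n\ge 0$ and $k$ let $C_p(n,k)$ denote the coefficient of $x^k$ in $p(x)^n$ (so $C_p(n,k)=0$ unless $0\le k\le nd$). Let $N\ge 1$ be an integer and $\delta\in(0,\tfrac14)$. Then there are a constant $C>0$ and an integer $n_0$, depending only on $p$, $\delta$ and $N$, such that the following holds. Let $\bar n\ge n_0$ and $\bar k\geq 0$ be integers with $$2\delta\bar n\le \bar k\le (d-2\delta)\bar n,\qquad 2\delta\bar n\le \bar n d-\bar k\le (d-2\delta)\bar n ,$$ let $\alpha_0,\dots,\alpha_{Nd}$ be real numbers with $\sum_{l=0}^{Nd}\alpha_l^2>0$, let $R\neq 0$ be a real number, and put $$\gamma_{n,k}=\frac1R\sum_{l=0}^{Nd}\alpha_l\,C_p(n-N,k-l).$$ Suppose that $|\gamma_{n,k}|\le 2$ for all integers $n,k$ satisfying $$N\le n\le\bar n,\qquad 0\le k\le\bar k,\qquad 0\le nd-k\le \bar nd-\bar k. \tag{$*$}$$ Then $$|\gamma_{n,k}|\le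 3e^{-C(\bar n-n)}\qquad\text{for all integers } n,k \text{ satisfying } (*).$$ -/

import Mathlib

namespace PolyAdic

open Polynomial

/-- The generating polynomial `p(x) = a₀ + a₁ x + ⋯ + a_d x^d` of a polynomial adic system:
its degree `d` is at least `1` and all the integers `a₀, …, a_d` are positive. -/
structure IsGenerating (p : ℕ[X]) : Prop where
  one_le_natDegree : 1 ≤ p.natDegree
  coeff_pos : ∀ i ≤ p.natDegree, 0 < p.coeff i

/-- The generalized binomial coefficient `C_p(n, k)`: the coefficient of `x^k` in `p(x)^n`
(in particular `0` for `k < 0` and for `k > n d`). -/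
noncomputable def genBinom (p : ℕ[X]) (n : ℕ) (k : ℤ) : ℕ :=
  if 0 ≤ k then (p ^ n).coeff k.toNat else 0

/-- The vertex `A = (n', k')` of the diagram of a polynomial of degree `d` is `δ`-separated from
the boundary vertices `(n', 0)` and `(n', d n')`. -/
def IsSeparated (d : ℕ) (δ : ℝ) (n' k' : ℕ) : Prop :=
  (2 * δ * (n' : ℝ) ≤ (k' : ℝ) ∧ (k' : ℝ) ≤ ((d : ℝ) - 2 * δ) * (n' : ℝ)) ∧
  (2 * δ * (n' : ℝ) ≤ (n' : ℝ) * d - k' ∧ (n' : ℝ) * d - k' ≤ ((d : ℝ) - 2 * δ) * (n' : ℝ))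

/-- The pair `(n, k)` is a vertex, with `N ≤ n ≤ n'`, of the diagram of a polynomial of degree `d`
from which the vertex `A = (n', k')` can be reached:
`0 ≤ k ≤ k'` and `0 ≤ n d - k ≤ n' d - k'`. -/
def IsBelow (d N n' k' n k : ℕ) : Prop :=
  (N ≤ n ∧ n ≤ n') ∧ k ≤ k' ∧
  (0 ≤ (n : ℤ) * d - k ∧ (n : ℤ) * d - k ≤ (n' : ℤ) * d - k')

/-- `γ_{n,k} = (1/R) ∑_{l=0}^{Nd} α_l C_p(n - N, k - l)`, used for `n ≥ N` only. -/
noncomputable def gam (p : ℕ[X]) (N : ℕ) (α : ℕ → ℝ) (R : ℝ) (n k : ℕ) : ℝ :=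
  (1 / R) * ∑ l ∈ Finset.range (N * p.natDegree + 1),
    α l * (genBinom p (n - N) ((k : ℤ) - (l : ℤ)) : ℝ)

end PolyAdic

/-! Fix the apex (n', k') and choose r > 0 so that the probability generating function φ(x) =
p(rx)/p(r) has mean (k' - Nd)/(n' - 2N). With h(x) = Σ α_l (rx)^l / R, the number γ_{n,k} is
p(r)^(n-N) r^(-k) times the coefficient of x^k in h φ^(n-N). Going down from the apex by s levels
and t ≤ ds columns multiplies this prefactor by r^t p(r)^(-s) ≤ (1+ρ)^(-s)
(`pow_mul_one_add_pow_le`), where ρ > 0 depends only on p and δ. It therefore suffices that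
coefficients of h φ^m bounded by B in a fixed window at the apex are O(b^s B) at depth s, with b =
√(1+ρ). This is `exists_abs_coeff_le_mul_pow`, and it rests on two estimates.

Large s: `sum_abs_coeff_le_of_window` bounds Σ|h_l| by a power of m times B. Correlating h with the
coefficients of h φ^m gives an average of |h|² against Re(φ^m x^(-k)) over roots of unity; at the
saddle point this weight is nonnegative near 1 and tiny elsewhere. As no coefficient of h φ^(m-s)
exceeds Σ|h_l|, this settles all s beyond a multiple of log m.

Small s: `IsProb.abs_coeff_le_principal_add_error` expands around x = 1 in powers of 1 - φ and x -
1. The truncated expansion uses only window coefficients and costs a polynomial in s. The remainder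
carries a high power of |x - 1|, which φ^(m-s) turns into a high negative power of m. -/

namespace PolyAdic

open Polynomial Finset

/-! ### Fourier and Vandermonde inversion on the unit circle -/

/-- Discrete Fourier inversion: a coefficient of a polynomial is an average over roots of unity. -/
lemma coeff_mul_eq_sum_roots {F : ℝ[X]} {T k : ℕ} {ζ : ℂ} (hζ : IsPrimitiveRoot ζ T)
    (hF : F.natDegree < T) (hk : k < T) :
    (F.coeff k : ℂ) * T = ∑ j ∈ range T, aeval (ζ ^ j) F * ((ζ ^ j)⁻¹) ^ k := by
  have hT : 0 < T := by omega
  have hζ0 : ζ ≠ 0 := hζ.ne_zero hT.ne'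
  have key : ∀ i ∈ range T, ∑ j ∈ range T, (F.coeff i : ℂ) * (ζ ^ i * (ζ⁻¹) ^ k) ^ j
      = if i = k then (F.coeff k : ℂ) * T else 0 := by
    intro i hi
    rw [← mul_sum]
    split_ifs with h
    · subst h
      have : ζ ^ i * (ζ⁻¹) ^ i = 1 := by
        rw [← mul_pow, mul_inv_cancel₀ hζ0, one_pow]
      simp only [this, one_pow, mul_one, sum_const, card_range, nsmul_eq_mul]
    · have hw : (ζ ^ i * (ζ⁻¹) ^ k) ≠ 1 := by
        intro hw
        apply h
        have : ζ ^ i = ζ ^ k := by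
          rw [inv_pow] at hw
          exact (mul_inv_eq_one₀ (pow_ne_zero _ hζ0)).1 hw
        exact hζ.pow_inj (mem_range.1 hi) hk this
      have hwT : (ζ ^ i * (ζ⁻¹) ^ k) ^ T = 1 := by
        rw [mul_pow, ← pow_mul, ← pow_mul, mul_comm i, mul_comm k, pow_mul, pow_mul, inv_pow,
          hζ.pow_eq_one]
        simp
      have := mul_geom_sum (ζ ^ i * (ζ⁻¹) ^ k) T
      rw [hwT, sub_self] at this
      rcases mul_eq_zero.1 this with h0 | h0
      · exact absurd (sub_eq_zero.1 h0) hw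
      · rw [h0, mul_zero]
  calc (F.coeff k : ℂ) * T
      = ∑ i ∈ range T, ∑ j ∈ range T, (F.coeff i : ℂ) * (ζ ^ i * (ζ⁻¹) ^ k) ^ j := by
        rw [sum_congr rfl key, sum_ite_eq' (range T) k, if_pos (mem_range.2 hk)]
    _ = ∑ j ∈ range T, ∑ i ∈ range T, (F.coeff i : ℂ) * (ζ ^ i * (ζ⁻¹) ^ k) ^ j := sum_comm
    _ = _ := by
        refine sum_congr rfl fun j _ => ?_
        rw [aeval_eq_sum_range' hF, sum_mul]
        refine sum_congr rfl fun i _ => ?_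
        rw [Complex.real_smul, mul_pow, mul_assoc, ← pow_mul, ← pow_mul, ← pow_mul, mul_comm i,
          ← inv_pow, ← pow_mul, mul_comm k]

/-- Cauchy's estimate on the unit circle. -/
lemma abs_coeff_le_of_norm_le {F : ℝ[X]} {M : ℝ}
    (hM : ∀ x : ℂ, ‖x‖ = 1 → ‖aeval x F‖ ≤ M) (k : ℕ) : |F.coeff k| ≤ M := by
  set T := F.natDegree + k + 1 with hTdef
  have hT : T ≠ 0 := by omega
  have hT' : (0 : ℝ) < T := by positivity
  have hζ := Complex.isPrimitiveRoot_exp T hT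
  set ζ := Complex.exp (2 * Real.pi * Complex.I / T)
  have hn : ‖ζ‖ = 1 := hζ.norm'_eq_one hT
  have h := coeff_mul_eq_sum_roots (F := F) (k := k) hζ (by omega) (by omega)
  have h2 : |F.coeff k| * T ≤ T * M := by
    calc |F.coeff k| * T = ‖(F.coeff k : ℂ) * T‖ := by simp
      _ ≤ ∑ j ∈ range T, ‖aeval (ζ ^ j) F * ((ζ ^ j)⁻¹) ^ k‖ := by
        rw [h]; exact norm_sum_le _ _
      _ ≤ ∑ j ∈ range T, M := by
        refine sum_le_sum fun j _ => ?_
        rw [norm_mul, norm_pow, norm_inv, norm_pow, hn]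
        simpa using hM (ζ ^ j) (by simp [hn])
      _ = T * M := by simp
  nlinarith

lemma norm_pow_sub_one_le {x : ℂ} (hx : ‖x‖ = 1) (j : ℕ) : ‖1 - x ^ j‖ ≤ j * ‖x - 1‖ := by
  induction j with
  | zero => simp
  | succ j ih =>
    have : 1 - x ^ (j + 1) = (1 - x ^ j) - x ^ j * (x - 1) := by ring
    rw [this]
    refine (norm_sub_le _ _).trans ?_
    rw [norm_mul, norm_pow, hx, one_pow]
    push_cast
    linarith

/-- Distinct roots of unity of order `T` are at distance at least `1 / T`. -/
lemma inv_le_norm_sub_of_pow_eq_one {T : ℕ} (hT : T ≠ 0) {w : ℂ} (hw : w ^ T = 1) (hw1 : w ≠ 1) :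
    1 / (T : ℝ) ≤ ‖w - 1‖ := by
  have hT' : (0 : ℝ) < T := by positivity
  have hn : ‖w‖ = 1 := Complex.norm_eq_one_of_pow_eq_one hw hT
  have h0 : ∑ j ∈ range T, w ^ j = 0 := by
    have := mul_geom_sum w T
    rw [hw, sub_self] at this
    exact (mul_eq_zero.1 this).resolve_left (sub_ne_zero.2 hw1)
  -- The powers of `w` sum to zero, so the T terms 1 - w^j sum to T, while each has norm at most T‖w
  -- - 1‖.
  have h1 : (T : ℝ) ≤ T * (T * ‖w - 1‖) := by
    calc (T : ℝ) = ‖∑ j ∈ range T, (1 - w ^ j)‖ := by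
          rw [sum_sub_distrib, h0]; simp
      _ ≤ ∑ j ∈ range T, (T * ‖w - 1‖) := by
          refine (norm_sum_le _ _).trans (sum_le_sum fun j hjT => (norm_pow_sub_one_le hn j).trans ?_)
          have : (j : ℝ) ≤ T := by exact_mod_cast (mem_range.1 hjT).le
          gcongr
      _ = T * (T * ‖w - 1‖) := by simp
  rw [div_le_iff₀ hT']
  nlinarith [norm_nonneg (w - 1)]

/-- Quantitative inversion of a Vandermonde system with unimodular nodes. -/
lemma norm_coeff_mul_pow_le_of_exp_sum_le {w : ℕ → ℂ} (hw : ∀ l, ‖w l‖ = 1) {κ : ℝ} (hκ : 0 ≤ κ)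
    (n : ℕ) : ∀ (s : Finset ℕ), s.card = n + 1 →
    (∀ a ∈ s, ∀ b ∈ s, a ≠ b → κ ≤ ‖w a - w b‖) → ∀ (c : ℕ → ℂ) (B : ℝ),
    (∀ j ≤ n, ‖∑ l ∈ s, c l * w l ^ j‖ ≤ B) → ∀ l ∈ s, ‖c l‖ * κ ^ n ≤ 2 ^ n * B := by
  induction n with
  | zero =>
    intro s hs _ c B hB l hl
    obtain ⟨a, rfl⟩ := card_eq_one.1 hs
    have := hB 0 le_rfl
    simp only [mem_singleton] at hl
    subst hl
    simpa using this
  | succ n ih =>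
    intro s hs hsep c B hB l hl
    -- Weighting `c x` by `w x - w a` removes the node `a`; the new power sums are differences of
    -- consecutive old ones, so the bound at most doubles.
    obtain ⟨a, ha, hal⟩ := exists_mem_ne (by omega : 1 < s.card) l
    have h := ih (s.erase a) (by rw [card_erase_of_mem ha]; omega)
      (fun x hx y hy => hsep x (mem_of_mem_erase hx) y (mem_of_mem_erase hy))
      (fun x => c x * (w x - w a)) (2 * B) ?_ l (mem_erase.2 ⟨hal.symm, hl⟩)
    · rw [norm_mul] at h
      have h2 := hsep l hl a ha hal.symm
      calc ‖c l‖ * κ ^ (n + 1) = ‖c l‖ * κ * κ ^ n := by ring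
        _ ≤ ‖c l‖ * ‖w l - w a‖ * κ ^ n := by gcongr
        _ ≤ 2 ^ n * (2 * B) := h
        _ = 2 ^ (n + 1) * B := by ring
    · intro j hj
      have : ∑ x ∈ s.erase a, c x * (w x - w a) * w x ^ j
          = ∑ x ∈ s, c x * w x ^ (j + 1) - w a * ∑ x ∈ s, c x * w x ^ j := by
        rw [sum_erase (s := s) (a := a) (f := fun x => c x * (w x - w a) * w x ^ j) (by simp),
          mul_sum, ← sum_sub_distrib]
        exact sum_congr rfl fun x _ => by ring
      rw [this]
      refine (norm_sub_le _ _).trans ?_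
      rw [norm_mul, hw, one_mul]
      linarith [hB j (by omega), hB (j + 1) (by omega)]

/-! ### Size and phase of a probability generating polynomial on the unit circle -/

/-- A polynomial with coefficients at least `ε` in degrees `0, …, d` and total mass one. -/
structure IsProb (φ : ℝ[X]) (d : ℕ) (ε : ℝ) : Prop where
  natDegree_le : φ.natDegree ≤ d
  le_coeff : ∀ i ≤ d, ε ≤ φ.coeff i
  sum_coeff : ∑ i ∈ range (d + 1), φ.coeff i = 1

lemma aeval_eq_sum_coeff_mul {F : ℝ[X]} {d : ℕ} (hF : F.natDegree ≤ d) (x : ℂ) :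
    aeval x F = ∑ i ∈ range (d + 1), (F.coeff i : ℂ) * x ^ i := by
  rw [aeval_eq_sum_range' (Nat.lt_succ_of_le hF)]
  simp

lemma norm_one_add_le {x : ℂ} (hx : ‖x‖ = 1) : ‖1 + x‖ ≤ 2 - ‖x - 1‖ ^ 2 / 4 := by
  have h1 : ‖x - 1‖ ≤ 2 := by
    refine (norm_sub_le _ _).trans ?_
    rw [hx, norm_one]; norm_num
  have h := parallelogram_law_with_norm ℝ (1 : ℂ) x
  rw [hx, norm_one, ← norm_sub_rev x 1] at h
  have h2 : 0 ≤ ‖x - 1‖ := norm_nonneg _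
  refine (pow_le_pow_iff_left₀ (norm_nonneg _) (by nlinarith) two_ne_zero).1 ?_
  nlinarith [sq_nonneg (‖x - 1‖ ^ 2)]

namespace IsProb

variable {φ : ℝ[X]} {d : ℕ} {ε : ℝ}

/-- The two lowest coefficients leave room to split off ε(1 + x), where cancellation occurs; the
remaining mass 1 - 2ε is estimated trivially. -/
lemma norm_aeval_le (hφ : IsProb φ d ε) (hd : 1 ≤ d) {x : ℂ} (hε : 0 < ε)
    (hx : ‖x‖ = 1) : ‖aeval x φ‖ ≤ 1 - ε * ‖x - 1‖ ^ 2 / 4 := by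
  obtain ⟨e, rfl⟩ : ∃ e, d = e + 1 := ⟨d - 1, by omega⟩
  have h1 := hφ.sum_coeff
  rw [aeval_eq_sum_coeff_mul hφ.natDegree_le]
  rw [sum_range_succ', sum_range_succ'] at h1 ⊢
  have c0 := hφ.le_coeff 0 (by omega)
  have c1 := hφ.le_coeff 1 (by omega)
  have h2 : ‖∑ i ∈ range e, (φ.coeff (i + 1 + 1) : ℂ) * x ^ (i + 1 + 1)‖
      ≤ ∑ i ∈ range e, φ.coeff (i + 1 + 1) := by
    refine (norm_sum_le _ _).trans (sum_le_sum fun i hi => ?_)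
    have := hφ.le_coeff (i + 1 + 1) (by have := mem_range.1 hi; omega)
    simp only [norm_mul, norm_pow, hx, one_pow, mul_one, Complex.norm_real]
    rw [Real.norm_of_nonneg (by linarith)]
  have e1 : ∀ S : ℂ, S + (φ.coeff (0 + 1) : ℂ) * x ^ (0 + 1) + (φ.coeff 0 : ℂ) * x ^ 0
      = S + ((φ.coeff 1 - ε : ℝ) : ℂ) * x + ((φ.coeff 0 - ε : ℝ) : ℂ) + (ε : ℂ) * (1 + x) := by
    intro S
    push_cast
    ring
  rw [e1]
  refine (norm_add_le _ _).trans ?_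
  have h3 := norm_add_le (∑ i ∈ range e, (φ.coeff (i + 1 + 1) : ℂ) * x ^ (i + 1 + 1)
    + ((φ.coeff 1 - ε : ℝ) : ℂ) * x) ((φ.coeff 0 - ε : ℝ) : ℂ)
  have h4 := norm_add_le (∑ i ∈ range e, (φ.coeff (i + 1 + 1) : ℂ) * x ^ (i + 1 + 1))
    (((φ.coeff 1 - ε : ℝ) : ℂ) * x)
  have h5 : ‖((φ.coeff 1 - ε : ℝ) : ℂ) * x‖ = φ.coeff 1 - ε := by
    rw [norm_mul, hx, Complex.norm_real, Real.norm_of_nonneg (by linarith), mul_one]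
  have h6 : ‖((φ.coeff 0 - ε : ℝ) : ℂ)‖ = φ.coeff 0 - ε := by
    rw [Complex.norm_real, Real.norm_of_nonneg (by linarith)]
  have h7 : ‖(ε : ℂ) * (1 + x)‖ ≤ ε * (2 - ‖x - 1‖ ^ 2 / 4) := by
    rw [norm_mul, Complex.norm_real, Real.norm_of_nonneg hε.le]
    exact mul_le_mul_of_nonneg_left (norm_one_add_le hx) hε.le
  rw [zero_add] at h1
  linarith

lemma norm_aeval_le_one (hφ : IsProb φ d ε) (hd : 1 ≤ d) (hε : 0 < ε) {x : ℂ}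
    (hx : ‖x‖ = 1) : ‖aeval x φ‖ ≤ 1 :=
  (hφ.norm_aeval_le hd hε hx).trans (by nlinarith [mul_nonneg hε.le (sq_nonneg ‖x - 1‖)])

lemma norm_aeval_pow_le_exp (hφ : IsProb φ d ε) (hd : 1 ≤ d) (hε : 0 < ε) {x : ℂ}
    (hx : ‖x‖ = 1) (m : ℕ) : ‖aeval x φ‖ ^ m ≤ Real.exp (-(ε * ‖x - 1‖ ^ 2 / 4 * m)) := by
  rw [show -(ε * ‖x - 1‖ ^ 2 / 4 * m) = m * (-(ε * ‖x - 1‖ ^ 2 / 4)) by ring, Real.exp_nat_mul]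
  gcongr
  have := Real.add_one_le_exp (-(ε * ‖x - 1‖ ^ 2 / 4))
  linarith [hφ.norm_aeval_le hd hε hx]

lemma norm_one_sub_aeval_le (hφ : IsProb φ d ε) (hε : 0 < ε) {x : ℂ} (hx : ‖x‖ = 1) :
    ‖1 - aeval x φ‖ ≤ d * ‖x - 1‖ := by
  have : 1 - aeval x φ = ∑ i ∈ range (d + 1), (φ.coeff i : ℂ) * (1 - x ^ i) := by
    simp only [mul_sub, mul_one, sum_sub_distrib]
    rw [← aeval_eq_sum_coeff_mul hφ.natDegree_le, ← Complex.ofReal_sum, hφ.sum_coeff]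
    simp
  rw [this]
  calc _ ≤ ∑ i ∈ range (d + 1), φ.coeff i * (d * ‖x - 1‖) := by
        refine (norm_sum_le _ _).trans (sum_le_sum fun i hi => ?_)
        have hi : i ≤ d := by have := mem_range.1 hi; omega
        have := hφ.le_coeff i hi
        rw [norm_mul, Complex.norm_real, Real.norm_of_nonneg (by linarith)]
        refine mul_le_mul_of_nonneg_left ((norm_pow_sub_one_le hx i).trans ?_) (by linarith)
        gcongr
    _ = d * ‖x - 1‖ := by rw [← sum_mul, hφ.sum_coeff, one_mul]

end IsProb

lemma norm_add_pow_sub_pow_le (a b : ℂ) (m : ℕ) :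
    ‖(a + b) ^ m - a ^ m‖ ≤ (‖a‖ + ‖b‖) ^ m - ‖a‖ ^ m := by
  induction m with
  | zero => simp
  | succ m ih =>
    have : (a + b) ^ (m + 1) - a ^ (m + 1)
        = (a + b) * ((a + b) ^ m - a ^ m) + b * a ^ m := by ring
    rw [this]
    refine (norm_add_le _ _).trans ?_
    rw [norm_mul, norm_mul, norm_pow]
    calc ‖a + b‖ * ‖(a + b) ^ m - a ^ m‖ + ‖b‖ * ‖a‖ ^ m
        ≤ (‖a‖ + ‖b‖) * ((‖a‖ + ‖b‖) ^ m - ‖a‖ ^ m) + ‖b‖ * ‖a‖ ^ m := by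
          gcongr
          exact norm_add_le _ _
      _ = _ := by ring

/-- The argument of z is O(1/m), so z^m stays close to the positive axis: it differs from (Re z)^m
by at most (e^(2/5) - 1)(Re z)^m, and e^(2/5) ≤ 5/3. -/
lemma pow_div_three_le_re_pow {z : ℂ} {m : ℕ} (hm : m ≠ 0) (hz : 0 < z.re)
    (h : |z.im| * (5 * m) ≤ 2 * z.re) : z.re ^ m / 3 ≤ (z ^ m).re := by
  have hm' : (0 : ℝ) < m := by positivity
  have h1 := norm_add_pow_sub_pow_le (z.re : ℂ) (z.im * Complex.I) m
  rw [Complex.re_add_im] at h1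
  have h2 : ‖(z.re : ℂ)‖ = z.re := by rw [Complex.norm_real, Real.norm_of_nonneg hz.le]
  have h3 : ‖(z.im : ℂ) * Complex.I‖ = |z.im| := by simp
  rw [h2, h3] at h1
  have h4 : (z.re + |z.im|) ^ m ≤ z.re ^ m * (5 / 3) := by
    have e1 : z.re + |z.im| ≤ z.re * Real.exp (2 / (5 * m)) := by
      have := Real.add_one_le_exp (2 / (5 * m) : ℝ)
      have h5 : |z.im| ≤ z.re * (2 / (5 * m)) := by
        rw [mul_div_assoc', le_div_iff₀ (by positivity)]; linarith
      nlinarith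
    calc (z.re + |z.im|) ^ m ≤ (z.re * Real.exp (2 / (5 * m))) ^ m := by gcongr
      _ = z.re ^ m * Real.exp (2 / 5) := by
        rw [mul_pow, ← Real.exp_nat_mul]
        congr 2
        field_simp
      _ ≤ z.re ^ m * (5 / 3) := by
        gcongr
        have e2 : Real.exp (2 / 5) ≤ Real.exp (1 / 2) := Real.exp_le_exp.2 (by norm_num)
        refine e2.trans ((pow_le_pow_iff_left₀ (by positivity) (by norm_num) two_ne_zero).1 ?_)
        rw [← Real.exp_nat_mul]
        have := Real.exp_one_lt_d9
        norm_num
        linarith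
  have h6 : (z ^ m - (z.re : ℂ) ^ m).re = (z ^ m).re - z.re ^ m := by
    rw [Complex.sub_re, ← Complex.ofReal_pow, Complex.ofReal_re]
  have h7 := (Complex.abs_re_le_norm (z ^ m - (z.re : ℂ) ^ m)).trans h1
  rw [h6] at h7
  have := (abs_le.1 h7).1
  linarith

lemma exists_exp_eq_of_norm_eq_one {x : ℂ} (hx : ‖x‖ = 1) :
    ∃ θ : ℝ, Complex.exp (θ * Complex.I) = x ∧ |θ| ≤ 2 * ‖x - 1‖ := by
  refine ⟨x.arg, by simpa [hx] using Complex.norm_mul_exp_arg_mul_I x, ?_⟩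
  have h := Complex.mul_angle_le_norm_sub hx (norm_one (α := ℂ))
  rw [Complex.angle_eq_abs_arg (norm_ne_zero_iff.1 (by rw [hx]; norm_num)) one_ne_zero, div_one,
    div_mul_eq_mul_div, div_le_iff₀ Real.pi_pos] at h
  have := Real.pi_lt_four
  nlinarith [norm_nonneg (x - 1)]

lemma abs_sin_sub_le {y : ℝ} (hy : |y| ≤ 1) : |Real.sin y - y| ≤ |y| ^ 3 / 5 := by
  have h := Real.sin_bound hy
  have h1 : |Real.sin y - y| ≤ |Real.sin y - (y - y ^ 3 / 6)| + |y| ^ 3 / 6 := by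
    have : Real.sin y - y = (Real.sin y - (y - y ^ 3 / 6)) - y ^ 3 / 6 := by ring
    rw [this]
    refine (abs_sub _ _).trans ?_
    rw [abs_div, abs_pow]
    norm_num
  have h2 : |y| ^ 5 ≤ |y| ^ 3 := pow_le_pow_of_le_one (abs_nonneg _) hy (by norm_num)
  have := pow_nonneg (abs_nonneg y) 3
  linarith

namespace IsProb

variable {φ : ℝ[X]} {d : ℕ} {ε : ℝ}

/-- Near the saddle point the powers of `φ` have almost no phase. -/
lemma le_re_aeval_pow_mul (hφ : IsProb φ d ε) (hε : 0 < ε) {m k : ℕ} (hm : m ≠ 0)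
    (hmean : (m : ℝ) * ∑ i ∈ range (d + 1), φ.coeff i * i = k) {x : ℂ} (hx : ‖x‖ = 1)
    (hxm : m * (2 * d * ‖x - 1‖) ^ 3 ≤ 1) :
    (1 - (2 * d * ‖x - 1‖) ^ 2 / 2) ^ m / 3 ≤ (aeval x φ ^ m * (x⁻¹) ^ k).re := by
  set q := 2 * d * ‖x - 1‖ with hq
  have hq0 : 0 ≤ q := by positivity
  have hm1 : (1 : ℝ) ≤ m := by exact_mod_cast Nat.one_le_iff_ne_zero.2 hm
  have hq1 : q ≤ 1 := by
    by_contra hcon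
    have : 1 < q ^ 3 := one_lt_pow₀ (not_le.1 hcon) (by norm_num)
    nlinarith
  set μ := ∑ i ∈ range (d + 1), φ.coeff i * i with hμ
  have hc : ∀ i ∈ range (d + 1), 0 ≤ φ.coeff i := fun i hi =>
    hε.le.trans (hφ.le_coeff i (by have := mem_range.1 hi; omega))
  have hμ0 : 0 ≤ μ := sum_nonneg fun i hi => mul_nonneg (hc i hi) (by positivity)
  have hμd : μ ≤ d := by
    calc μ ≤ ∑ i ∈ range (d + 1), φ.coeff i * d := by
          refine sum_le_sum fun i hi => mul_le_mul_of_nonneg_left ?_ (hc i hi)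
          have := mem_range.1 hi
          exact_mod_cast (by omega : i ≤ d)
      _ = d := by rw [← sum_mul, hφ.sum_coeff, one_mul]
  obtain ⟨θ, hθ, hθle⟩ := exists_exp_eq_of_norm_eq_one hx
  -- Centring at the mean μ: as mμ = k, z^m is exactly the quantity to be estimated.
  set z : ℂ := ∑ i ∈ range (d + 1), (φ.coeff i : ℂ) *
    Complex.exp ((((i - μ) * θ : ℝ) : ℂ) * Complex.I) with hz
  have hzφ : z = aeval x φ * Complex.exp (-(μ * θ : ℝ) * Complex.I) := by
    rw [hz, aeval_eq_sum_coeff_mul hφ.natDegree_le, sum_mul]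
    refine sum_congr rfl fun i _ => ?_
    rw [← hθ, ← Complex.exp_nat_mul, mul_assoc, ← Complex.exp_add]
    congr 2
    push_cast
    ring
  have hzm : z ^ m = aeval x φ ^ m * (x⁻¹) ^ k := by
    rw [hzφ, mul_pow, ← hθ, ← Complex.exp_neg, ← Complex.exp_nat_mul, ← Complex.exp_nat_mul]
    congr 2
    have : ((m : ℝ) : ℂ) * (μ : ℂ) = ((k : ℝ) : ℂ) := by rw [← hmean]; push_cast; ring
    push_cast at this ⊢
    linear_combination (-θ * Complex.I) * this
  have hy : ∀ i ∈ range (d + 1), |((i : ℝ) - μ) * θ| ≤ q := by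
    intro i hi
    have hi : (i : ℝ) ≤ d := by
      have := mem_range.1 hi
      exact_mod_cast (by omega : i ≤ d)
    have : |(i : ℝ) - μ| ≤ d := by
      rw [abs_le]; constructor <;> linarith [(Nat.cast_nonneg i : (0 : ℝ) ≤ i)]
    rw [abs_mul]
    calc _ ≤ (d : ℝ) * (2 * ‖x - 1‖) := by gcongr
      _ = q := by rw [hq]; ring
  have hre : 1 - q ^ 2 / 2 ≤ z.re := by
    have : z.re = ∑ i ∈ range (d + 1), φ.coeff i * Real.cos ((i - μ) * θ) := by
      rw [hz, Complex.re_sum]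
      refine sum_congr rfl fun i _ => ?_
      rw [Complex.re_ofReal_mul, Complex.exp_ofReal_mul_I_re]
    rw [this]
    calc 1 - q ^ 2 / 2 = ∑ i ∈ range (d + 1), φ.coeff i * (1 - q ^ 2 / 2) := by
          rw [← sum_mul, hφ.sum_coeff, one_mul]
      _ ≤ _ := by
          refine sum_le_sum fun i hi => mul_le_mul_of_nonneg_left ?_ (hc i hi)
          refine le_trans ?_ Real.one_sub_sq_div_two_le_cos
          have := sq_le_sq.2 ((hy i hi).trans (le_abs_self q))
          linarith
  -- Centring cancels the terms linear in θ, so the imaginary part is cubic in q. Then 5m|Im z| ≤ m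
  -- q³ ≤ 1 ≤ 2 Re z, as `pow_div_three_le_re_pow` requires.
  have him : |z.im| ≤ q ^ 3 / 5 := by
    have h1 : z.im = ∑ i ∈ range (d + 1),
        φ.coeff i * (Real.sin ((i - μ) * θ) - (i - μ) * θ) := by
      have h0 : ∑ i ∈ range (d + 1), φ.coeff i * ((i - μ) * θ) = 0 := by
        have : ∀ i ∈ range (d + 1), φ.coeff i * ((i - μ) * θ)
            = (φ.coeff i * i) * θ - φ.coeff i * (μ * θ) := fun i _ => by ring
        rw [sum_congr rfl this, sum_sub_distrib, ← sum_mul, ← sum_mul, hφ.sum_coeff, ← hμ]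
        ring
      simp only [mul_sub (φ.coeff _) (Real.sin _)]
      rw [sum_sub_distrib, h0, sub_zero, hz, Complex.im_sum]
      refine sum_congr rfl fun i _ => ?_
      rw [Complex.im_ofReal_mul, Complex.exp_ofReal_mul_I_im]
    rw [h1]
    calc _ ≤ ∑ i ∈ range (d + 1), φ.coeff i * (q ^ 3 / 5) := by
          refine (abs_sum_le_sum_abs _ _).trans (sum_le_sum fun i hi => ?_)
          rw [abs_mul, abs_of_nonneg (hc i hi)]
          refine mul_le_mul_of_nonneg_left ((abs_sin_sub_le ((hy i hi).trans hq1)).trans ?_)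
            (hc i hi)
          have := hy i hi
          gcongr
      _ = q ^ 3 / 5 := by rw [← sum_mul, hφ.sum_coeff, one_mul]
  have hhalf : 1 / 2 ≤ 1 - q ^ 2 / 2 := by nlinarith
  rw [← hzm]
  refine le_trans ?_ (pow_div_three_le_re_pow hm (by linarith) ?_)
  · gcongr
  · nlinarith
end IsProb

lemma norm_aeval_le_sum_abs {h : ℝ[X]} {J : ℕ} (hJ : h.natDegree ≤ J) {x : ℂ} (hx : ‖x‖ = 1) :
    ‖aeval x h‖ ≤ ∑ l ∈ range (J + 1), |h.coeff l| := by
  rw [aeval_eq_sum_coeff_mul hJ]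
  refine (norm_sum_le _ _).trans (sum_le_sum fun i _ => ?_)
  simp [hx]

/-- Away from the saddle point the powers of `φ` decay faster than any power. -/
lemma IsProb.norm_aeval_pow_le_of_far {d : ℕ} (hd : 1 ≤ d) {ε : ℝ} (hε : 0 < ε) (Q : ℕ) :
    ∃ K : ℝ, 0 < K ∧ ∀ (φ : ℝ[X]) (m : ℕ) (x : ℂ), IsProb φ d ε → ‖x‖ = 1 →
      1 < m * (2 * d * ‖x - 1‖) ^ 3 → ‖aeval x φ‖ ^ m ≤ K / (m : ℝ) ^ Q := by
  have hd0 : (0 : ℝ) < d := by exact_mod_cast hd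
  refine ⟨(3 * Q).factorial * ((4 / ε) ^ 3 * (2 * d) ^ 6) ^ Q, by positivity, ?_⟩
  intro φ m x hφ hx hfar
  have hm : (0 : ℝ) < m := by
    rcases Nat.eq_zero_or_pos m with h | h
    · subst h; norm_num at hfar
    · exact_mod_cast h
  have hu : 0 < ‖x - 1‖ := by
    rcases (norm_nonneg (x - 1)).eq_or_lt with h | h
    · rw [← h] at hfar; norm_num at hfar
    · exact h
  set y := ε * ‖x - 1‖ ^ 2 / 4 * m with hy
  have hy0 : 0 < y := by positivity
  refine (hφ.norm_aeval_pow_le_exp hd hε hx m).trans ?_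
  rw [← hy, Real.exp_neg]
  have h1 := Real.pow_div_factorial_le_exp y hy0.le (3 * Q)
  -- Up to a constant y³ is m (m‖x - 1‖³)², so being far from 1 forces y to be at least of order
  -- m^(1/3); hence the exponent 3Q in the bound for e^y.
  have h2 : (m : ℝ) ≤ ((4 / ε) ^ 3 * (2 * d) ^ 6) * y ^ 3 := by
    have e : ((4 / ε) ^ 3 * (2 * d) ^ 6) * y ^ 3 = m * (m * (2 * d * ‖x - 1‖) ^ 3) ^ 2 := by
      rw [hy]; field_simp
    rw [e]
    nlinarith [one_lt_pow₀ hfar two_ne_zero]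
  have h3 : (m : ℝ) ^ Q ≤ ((4 / ε) ^ 3 * (2 * d) ^ 6) ^ Q * y ^ (3 * Q) := by
    rw [pow_mul y, ← mul_pow]
    exact pow_le_pow_left₀ hm.le h2 Q
  rw [inv_le_iff_one_le_mul₀ (Real.exp_pos _), div_mul_eq_mul_div, le_div_iff₀ (by positivity),
    one_mul]
  have hf : (0 : ℝ) < (3 * Q).factorial := by positivity
  rw [div_le_iff₀ hf] at h1
  calc (m : ℝ) ^ Q ≤ ((4 / ε) ^ 3 * (2 * d) ^ 6) ^ Q * y ^ (3 * Q) := h3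
    _ ≤ ((4 / ε) ^ 3 * (2 * d) ^ 6) ^ Q * (Real.exp y * (3 * Q).factorial) := by gcongr
    _ = _ := by ring

namespace IsProb

variable {φ : ℝ[X]} {d : ℕ} {ε : ℝ}

lemma re_aeval_pow_mul_nonneg (hφ : IsProb φ d ε) (hε : 0 < ε) {m k : ℕ} (hm : m ≠ 0)
    (hmean : (m : ℝ) * ∑ i ∈ range (d + 1), φ.coeff i * i = k) {x : ℂ} (hx : ‖x‖ = 1)
    (hxm : m * (2 * d * ‖x - 1‖) ^ 3 ≤ 1) :
    0 ≤ (aeval x φ ^ m * (x⁻¹) ^ k).re := by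
  refine le_trans ?_ (hφ.le_re_aeval_pow_mul hε hm hmean hx hxm)
  have hm1 : (1 : ℝ) ≤ m := by exact_mod_cast Nat.one_le_iff_ne_zero.2 hm
  have hq0 : 0 ≤ 2 * d * ‖x - 1‖ := by positivity
  have hq1 : 2 * d * ‖x - 1‖ ≤ 1 := by
    by_contra hcon
    have : 1 < (2 * d * ‖x - 1‖) ^ 3 := one_lt_pow₀ (not_le.1 hcon) (by norm_num)
    nlinarith
  have : 0 ≤ 1 - (2 * d * ‖x - 1‖) ^ 2 / 2 := by nlinarith
  positivity

/-- In the smaller neighbourhood m q² ≤ 1, Bernoulli's inequality gives (1 - q²/2)^m ≥ 1/2, so the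
weight is not only nonnegative but bounded below. -/
lemma one_div_six_le_re_aeval_pow_mul (hφ : IsProb φ d ε) (hε : 0 < ε) {m k : ℕ} (hm : m ≠ 0)
    (hmean : (m : ℝ) * ∑ i ∈ range (d + 1), φ.coeff i * i = k) {x : ℂ} (hx : ‖x‖ = 1)
    (hxm : m * (2 * d * ‖x - 1‖) ^ 2 ≤ 1) :
    1 / 6 ≤ (aeval x φ ^ m * (x⁻¹) ^ k).re := by
  have hm1 : (1 : ℝ) ≤ m := by exact_mod_cast Nat.one_le_iff_ne_zero.2 hm
  have key := hφ.le_re_aeval_pow_mul hε hm hmean hx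
  set q := 2 * d * ‖x - 1‖ with hq
  have hq0 : 0 ≤ q := by positivity
  have hq1 : q ≤ 1 := by
    by_contra hcon
    have : 1 < q ^ 2 := one_lt_pow₀ (not_le.1 hcon) (by norm_num)
    nlinarith
  have hq3 : m * q ^ 3 ≤ 1 := by
    have : q ^ 3 ≤ q ^ 2 := pow_le_pow_of_le_one hq0 hq1 (by norm_num)
    nlinarith
  refine le_trans ?_ (key hq3)
  have := one_add_mul_le_pow (a := -(q ^ 2 / 2)) (by nlinarith) m
  rw [← sub_eq_add_neg] at this
  linarith

end IsProb

/-! ### Recovering h from a window of coefficients at the saddle point -/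

/-- A Parseval identity: after Fourier inversion, the sum of h_l x^(-l) is the conjugate of h(x) on
the circle, so h enters only through |h|². A lower bound then needs only the sign of the remaining
real part. -/
lemma sum_coeff_mul_coeff_mul_eq {h φ : ℝ[X]} {J m k T : ℕ} {ζ : ℂ} (hζ : IsPrimitiveRoot ζ T)
    (hJ : h.natDegree ≤ J) (hT : (h * φ ^ m).natDegree < T) (hk : k + J < T) :
    (∑ l ∈ range (J + 1), h.coeff l * (h * φ ^ m).coeff (k + l)) * T
      = ∑ j ∈ range T, ‖aeval (ζ ^ j) h‖ ^ 2 *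
        (aeval (ζ ^ j) φ ^ m * ((ζ ^ j)⁻¹) ^ k).re := by
  have hT0 : T ≠ 0 := by omega
  have hn : ‖ζ‖ = 1 := hζ.norm'_eq_one hT0
  have key : (((∑ l ∈ range (J + 1), h.coeff l * (h * φ ^ m).coeff (k + l)) * T : ℝ) : ℂ)
      = ∑ j ∈ range T, ((‖aeval (ζ ^ j) h‖ ^ 2 : ℝ) : ℂ) *
        (aeval (ζ ^ j) φ ^ m * ((ζ ^ j)⁻¹) ^ k) := by
    push_cast
    rw [sum_mul]
    calc _ = ∑ l ∈ range (J + 1), ∑ j ∈ range T, (h.coeff l : ℂ) *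
          (aeval (ζ ^ j) (h * φ ^ m) * ((ζ ^ j)⁻¹) ^ (k + l)) := by
          refine sum_congr rfl fun l hl => ?_
          rw [mul_assoc, coeff_mul_eq_sum_roots hζ hT (by have := mem_range.1 hl; omega), mul_sum]
      _ = _ := by
          rw [sum_comm]
          refine sum_congr rfl fun j _ => ?_
          have hx : ‖ζ ^ j‖ = 1 := by simp [hn]
          have hc : ∑ l ∈ range (J + 1), (h.coeff l : ℂ) * ((ζ ^ j)⁻¹) ^ l
              = (starRingEnd ℂ) (aeval (ζ ^ j) h) := by
            rw [aeval_eq_sum_coeff_mul hJ, map_sum]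
            refine sum_congr rfl fun l _ => ?_
            rw [map_mul, map_pow, Complex.conj_ofReal, Complex.inv_eq_conj hx]
          calc _ = (aeval (ζ ^ j) (h * φ ^ m) * ((ζ ^ j)⁻¹) ^ k) *
                ∑ l ∈ range (J + 1), (h.coeff l : ℂ) * ((ζ ^ j)⁻¹) ^ l := by
                rw [mul_sum]
                exact sum_congr rfl fun l _ => by rw [pow_add]; ring
            _ = _ := by
                rw [hc, map_mul, map_pow]
                have := Complex.mul_conj' (aeval (ζ ^ j) h)
                rw [← this]
                ring
  have := congrArg Complex.re key
  rw [Complex.ofReal_re, Complex.re_sum] at this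
  rw [this]
  exact sum_congr rfl fun j _ => Complex.re_ofReal_mul _ _

/-- Values at consecutive roots of unity control the coefficients. -/
lemma sq_sum_abs_coeff_le {h : ℝ[X]} {J T : ℕ} {ζ : ℂ} (hζ : IsPrimitiveRoot ζ T)
    (hJ : h.natDegree ≤ J) (hT : J < T) :
    (∑ l ∈ range (J + 1), |h.coeff l|) ^ 2 ≤
      (J + 1) ^ 2 * 4 ^ J * (T : ℝ) ^ (2 * J) * ∑ j ∈ range (J + 1), ‖aeval (ζ ^ j) h‖ ^ 2 := by
  have hT0 : T ≠ 0 := by omega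
  have hT' : (0 : ℝ) < T := by positivity
  have hn : ‖ζ‖ = 1 := hζ.norm'_eq_one hT0
  have hζ0 : ζ ≠ 0 := hζ.ne_zero hT0
  set S := ∑ j ∈ range (J + 1), ‖aeval (ζ ^ j) h‖ ^ 2 with hS
  have hS0 : 0 ≤ S := sum_nonneg fun _ _ => by positivity
  have hsep : ∀ a ∈ range (J + 1), ∀ b ∈ range (J + 1), a ≠ b →
      1 / (T : ℝ) ≤ ‖ζ ^ a - ζ ^ b‖ := by
    intro a ha b hb hab
    have ha := mem_range.1 ha
    have hb := mem_range.1 hb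
    have h1 : ζ ^ a * (ζ ^ b)⁻¹ ≠ 1 := by
      intro h1
      exact hab (hζ.pow_inj (by omega) (by omega)
        ((mul_inv_eq_one₀ (pow_ne_zero _ hζ0)).1 h1))
    have h2 : (ζ ^ a * (ζ ^ b)⁻¹) ^ T = 1 := by
      rw [mul_pow, inv_pow, ← pow_mul, ← pow_mul, mul_comm a, mul_comm b, pow_mul, pow_mul,
        hζ.pow_eq_one]
      simp
    have h3 := inv_le_norm_sub_of_pow_eq_one hT0 h2 h1
    have h4 : ζ ^ a - ζ ^ b = (ζ ^ a * (ζ ^ b)⁻¹ - 1) * ζ ^ b := by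
      rw [sub_mul, inv_mul_cancel_right₀ (pow_ne_zero _ hζ0), one_mul]
    rw [h4, norm_mul, norm_pow, hn, one_pow, mul_one]
    exact h3
  have hl : ∀ l ∈ range (J + 1), |h.coeff l| ≤ 2 ^ J * (T : ℝ) ^ J * √S := by
    intro l hl
    have := norm_coeff_mul_pow_le_of_exp_sum_le (w := fun l => ζ ^ l) (fun l => by simp [hn])
      (κ := 1 / (T : ℝ)) (by positivity) J (range (J + 1)) (card_range _) hsep
      (fun l => (h.coeff l : ℂ)) (√S) ?_ l hl
    · rw [Complex.norm_real, Real.norm_eq_abs, div_pow, one_pow, mul_one_div,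
        div_le_iff₀ (by positivity)] at this
      linarith
    · intro j hj
      have : ∑ l ∈ range (J + 1), (h.coeff l : ℂ) * (ζ ^ l) ^ j = aeval (ζ ^ j) h := by
        rw [aeval_eq_sum_coeff_mul hJ]
        refine sum_congr rfl fun l _ => ?_
        rw [← pow_mul, ← pow_mul, mul_comm l]
      rw [this]
      apply Real.le_sqrt_of_sq_le
      exact single_le_sum (f := fun j => ‖aeval (ζ ^ j) h‖ ^ 2) (fun _ _ => by positivity)
        (mem_range.2 (by omega : j < J + 1))
  have hsum := sum_le_sum hl
  rw [sum_const, card_range, nsmul_eq_mul] at hsum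
  calc (∑ l ∈ range (J + 1), |h.coeff l|) ^ 2
      ≤ (((J + 1 : ℕ) : ℝ) * (2 ^ J * (T : ℝ) ^ J * √S)) ^ 2 :=
        pow_le_pow_left₀ (sum_nonneg fun _ _ => abs_nonneg _) hsum 2
    _ = (J + 1) ^ 2 * (2 ^ J) ^ 2 * (T : ℝ) ^ (2 * J) * (√S) ^ 2 := by push_cast; ring
    _ = _ := by rw [Real.sq_sqrt hS0, pow_right_comm]; norm_num

lemma mul_div_pow_le {T C K c m : ℝ} {n : ℕ} (hK : 0 ≤ K) (hc : 0 < c) (hm : 0 < m)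
    (hT : T ≤ C * m) (h : 2 * C * K / c ≤ m) : T * (K / m ^ (n + 2)) ≤ c / 2 / m ^ n := by
  calc T * (K / m ^ (n + 2)) ≤ C * m * (K / m ^ (n + 2)) := by gcongr
    _ = C * K / m / m ^ n := by
      rw [pow_add]; field_simp
    _ ≤ c / 2 / m ^ n := by
      refine div_le_div_of_nonneg_right ?_ (by positivity)
      rw [div_le_iff₀ hm]
      rw [div_le_iff₀ hc] at h
      linarith

set_option maxHeartbeats 1000000 in
/-- At the saddle point the coefficients of `h φ ^ m` in a bounded window control the
coefficients of `h` up to a power of `m`. -/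
lemma sum_abs_coeff_le_of_window {d : ℕ} (hd : 1 ≤ d) (J : ℕ) {ε : ℝ} (hε : 0 < ε) :
    ∃ (K : ℝ) (m₀ : ℕ), 0 < K ∧ ∀ (m k : ℕ) (φ h : ℝ[X]) (B : ℝ), m₀ ≤ m → IsProb φ d ε →
      (m : ℝ) * ∑ i ∈ range (d + 1), φ.coeff i * i = k → h.natDegree ≤ J →
      (∀ l ≤ J, |(h * φ ^ m).coeff (k + l)| ≤ B) →
      ∑ l ∈ range (J + 1), |h.coeff l| ≤ K * (m : ℝ) ^ (2 * J + 1) * B := by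
  have hd0 : (0 : ℝ) < d := by exact_mod_cast hd
  have hd1 : (1 : ℝ) ≤ d := by exact_mod_cast hd
  -- The exponent 2J + 2 beats the loss m^(2J) of the Vandermonde inversion and the O(m) roots of
  -- unity, with one power of m to spare.
  obtain ⟨K, hK, hfar⟩ := IsProb.norm_aeval_pow_le_of_far hd hε (2 * J + 2)
  set C : ℝ := d + 2 * J + 1 with hC
  have hC0 : 0 < C := by positivity
  -- The constant in S/6 ≥ c H²/m^(2J), obtained from `sq_sum_abs_coeff_le` and T ≤ C m.
  set c : ℝ := 1 / (6 * (J + 1) ^ 2 * 4 ^ J * C ^ (2 * J)) with hc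
  have hc0 : 0 < c := by positivity
  obtain ⟨m₁, hm₁⟩ := exists_nat_ge (2 * C * K / c)
  refine ⟨2 * C / c, m₁ + 256 * J ^ 2 + 16 * J + 1, by positivity, ?_⟩
  intro m k φ h B hm hφ hmean hJ hB
  have hm1 : 1 ≤ m := by omega
  have hmR : (1 : ℝ) ≤ m := by exact_mod_cast hm1
  have hm0 : (0 : ℝ) < m := by linarith
  have hmm₁ : 2 * C * K / c ≤ m := hm₁.trans (by exact_mod_cast (by omega : m₁ ≤ m))
  have hmJ2 : 256 * (J : ℝ) ^ 2 ≤ m := by exact_mod_cast (by omega : 256 * J ^ 2 ≤ m)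
  have hmJ : 16 * (J : ℝ) ≤ m := by exact_mod_cast (by omega : 16 * J ≤ m)
  have hcoef : ∀ i ∈ range (d + 1), 0 ≤ φ.coeff i := fun i hi =>
    hε.le.trans (hφ.le_coeff i (by have := mem_range.1 hi; omega))
  have hkm : k ≤ m * d := by
    have : (k : ℝ) ≤ m * d := by
      rw [← hmean]
      refine mul_le_mul_of_nonneg_left ?_ hm0.le
      calc _ ≤ ∑ i ∈ range (d + 1), φ.coeff i * d := by
            refine sum_le_sum fun i hi => mul_le_mul_of_nonneg_left ?_ (hcoef i hi)
            have := mem_range.1 hi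
            exact_mod_cast (by omega : i ≤ d)
        _ = d := by rw [← sum_mul, hφ.sum_coeff, one_mul]
    exact_mod_cast this
  set T := m * d + 2 * J + 1 with hT
  have hT0 : T ≠ 0 := by omega
  have hTpos : (0 : ℝ) < T := by positivity
  have hTm : (m : ℝ) * d ≤ T := by rw [hT]; push_cast; linarith [(Nat.cast_nonneg J : (0 : ℝ) ≤ J)]
  have hTC : (T : ℝ) ≤ C * m := by
    rw [hT, hC]; push_cast
    nlinarith [(Nat.cast_nonneg J : (0 : ℝ) ≤ J)]
  have hdeg : (h * φ ^ m).natDegree < T := by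
    have h1 : (φ ^ m).natDegree ≤ m * d := natDegree_pow_le_of_le m hφ.natDegree_le
    have h2 := natDegree_mul_le (p := h) (q := φ ^ m)
    omega
  have hζ := Complex.isPrimitiveRoot_exp T hT0
  have hζ1 : ‖Complex.exp (2 * Real.pi * Complex.I / T) - 1‖ ≤ 8 / T := by
    have e : (2 * Real.pi * Complex.I / T : ℂ) = Complex.I * ((2 * Real.pi / T : ℝ) : ℂ) := by
      push_cast; ring
    rw [e]
    refine Real.norm_exp_I_mul_ofReal_sub_one_le.trans ?_
    rw [Real.norm_of_nonneg (by positivity)]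
    gcongr
    linarith [Real.pi_lt_four]
  set ζ := Complex.exp (2 * Real.pi * Complex.I / T)
  have hn : ‖ζ‖ = 1 := hζ.norm'_eq_one hT0
  set H := ∑ l ∈ range (J + 1), |h.coeff l| with hH
  have hH0 : 0 ≤ H := sum_nonneg fun _ _ => abs_nonneg _
  set τ := K / (m : ℝ) ^ (2 * J + 2) with hτ
  have hτ0 : 0 ≤ τ := by positivity
  have hB0 : 0 ≤ B := (abs_nonneg _).trans (hB 0 (by omega))
  set S := ∑ j ∈ range (J + 1), ‖aeval (ζ ^ j) h‖ ^ 2 with hS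
  have hxn : ∀ j : ℕ, ‖ζ ^ j‖ = 1 := fun j => by simp [hn]
  have hw : ∀ j : ℕ, -τ ≤ (aeval (ζ ^ j) φ ^ m * ((ζ ^ j)⁻¹) ^ k).re := by
    intro j
    rcases le_or_gt ((m : ℝ) * (2 * d * ‖ζ ^ j - 1‖) ^ 3) 1 with hnear | hf
    · linarith [hφ.re_aeval_pow_mul_nonneg hε (by omega) hmean (hxn j) hnear]
    · have h1 := hfar φ m (ζ ^ j) hφ (hxn j) hf
      have h2 := (Complex.abs_re_le_norm (aeval (ζ ^ j) φ ^ m * ((ζ ^ j)⁻¹) ^ k))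
      rw [norm_mul, norm_pow, norm_pow, norm_inv, hxn j, inv_one, one_pow, mul_one] at h2
      have := (abs_le.1 (h2.trans h1)).1
      exact this
  -- The roots ζ^j with j ≤ J satisfy q m ≤ 16J, hence m q² ≤ 1 once m ≥ 256J².
  have hwJ : ∀ j ≤ J, 1 / 6 ≤ (aeval (ζ ^ j) φ ^ m * ((ζ ^ j)⁻¹) ^ k).re := by
    intro j hj
    set q := 2 * d * ‖ζ ^ j - 1‖ with hq
    have hq0 : 0 ≤ q := by positivity
    have hqm : q * m ≤ 16 * J := by
      have h1 : ‖ζ ^ j - 1‖ ≤ J * (8 / T) := by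
        rw [norm_sub_rev]
        refine (norm_pow_sub_one_le hn j).trans ?_
        have : (j : ℝ) ≤ J := by exact_mod_cast hj
        gcongr
      calc q * m ≤ 2 * d * (J * (8 / T)) * m := by rw [hq]; gcongr
        _ = 16 * J * ((m * d) / T) := by ring
        _ ≤ 16 * J * 1 := by
          gcongr
          exact (div_le_one hTpos).2 hTm
        _ = 16 * J := by ring
    refine hφ.one_div_six_le_re_aeval_pow_mul hε (by omega) hmean (hxn j) ?_
    rw [← hq]
    have : (q * m) ^ 2 ≤ (16 * J) ^ 2 := pow_le_pow_left₀ (by positivity) hqm 2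
    refine le_of_mul_le_mul_right ?_ hm0
    linarith
  -- Only the first J + 1 roots are kept; every other term is at least -τH².
  have hlow : S / 6 - T * (τ * H ^ 2) ≤ ∑ j ∈ range T, ‖aeval (ζ ^ j) h‖ ^ 2 *
        (aeval (ζ ^ j) φ ^ m * ((ζ ^ j)⁻¹) ^ k).re := by
    have h1 : S / 6 = ∑ j ∈ range T, if j ∈ range (J + 1) then ‖aeval (ζ ^ j) h‖ ^ 2 / 6 else 0 := by
      rw [← sum_filter, hS, sum_div]
      refine sum_congr ?_ fun _ _ => rfl
      ext j
      simp only [mem_filter, mem_range]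
      omega
    have h2 : (T : ℝ) * (τ * H ^ 2) = ∑ j ∈ range T, τ * H ^ 2 := by simp
    rw [h1, h2, ← sum_sub_distrib]
    refine sum_le_sum fun j _ => ?_
    have h3 : ‖aeval (ζ ^ j) h‖ ^ 2 ≤ H ^ 2 :=
      pow_le_pow_left₀ (norm_nonneg _) (norm_aeval_le_sum_abs hJ (hxn j)) 2
    have h4 : 0 ≤ ‖aeval (ζ ^ j) h‖ ^ 2 := by positivity
    split_ifs with hj
    · have := hwJ j (by have := mem_range.1 hj; omega)
      nlinarith [mul_nonneg hτ0 (sq_nonneg H)]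
    · nlinarith [hw j]
  rw [← sum_coeff_mul_coeff_mul_eq hζ hJ hdeg (by omega)] at hlow
  have hup : (∑ l ∈ range (J + 1), h.coeff l * (h * φ ^ m).coeff (k + l)) ≤ H * B := by
    rw [hH, sum_mul]
    refine sum_le_sum fun l hl => (le_abs_self _).trans ?_
    rw [abs_mul]
    exact mul_le_mul_of_nonneg_left (hB l (by have := mem_range.1 hl; omega)) (abs_nonneg _)
  have hmain : S / 6 - T * (τ * H ^ 2) ≤ H * B * T :=
    hlow.trans (mul_le_mul_of_nonneg_right hup hTpos.le)
  have hSH := sq_sum_abs_coeff_le hζ hJ (by omega : J < T)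
  rw [← hH, ← hS] at hSH
  have hS0 : 0 ≤ S := sum_nonneg fun _ _ => by positivity
  have hfin : c / 2 / (m : ℝ) ^ (2 * J) * H ^ 2 ≤ H * B * (C * m) := by
    have hSlow : c / (m : ℝ) ^ (2 * J) * H ^ 2 ≤ S / 6 := by
      have e : c / (m : ℝ) ^ (2 * J) * H ^ 2
          = H ^ 2 / (6 * ((J + 1) ^ 2 * 4 ^ J * (C * m) ^ (2 * J))) := by
        rw [hc, mul_pow]; field_simp
      rw [e, div_le_div_iff₀ (by positivity) (by norm_num)]
      have : (J + 1) ^ 2 * 4 ^ J * (T : ℝ) ^ (2 * J) * S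
          ≤ (J + 1) ^ 2 * 4 ^ J * (C * m) ^ (2 * J) * S := by gcongr
      linarith
    have hτlow : T * (τ * H ^ 2) ≤ c / 2 / (m : ℝ) ^ (2 * J) * H ^ 2 := by
      have := mul_div_pow_le (n := 2 * J) hK.le hc0 hm0 hTC hmm₁
      calc T * (τ * H ^ 2) = T * τ * H ^ 2 := by ring
        _ ≤ _ := by gcongr
    have h1 : c / (m : ℝ) ^ (2 * J) * H ^ 2
        = c / 2 / (m : ℝ) ^ (2 * J) * H ^ 2 + c / 2 / (m : ℝ) ^ (2 * J) * H ^ 2 := by ring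
    have h2 : H * B * T ≤ H * B * (C * m) := by gcongr
    linarith
  rcases hH0.eq_or_lt with h0 | h0
  · rw [← h0]; positivity
  have h5 : c / 2 / (m : ℝ) ^ (2 * J) * H ≤ B * (C * m) := by
    refine le_of_mul_le_mul_right ?_ h0
    linarith
  rw [div_mul_eq_mul_div, div_le_iff₀ (by positivity)] at h5
  have e : 2 * C / c * (m : ℝ) ^ (2 * J + 1) * B = B * (C * m) * (m : ℝ) ^ (2 * J) * 2 / c := by
    rw [pow_succ]; ring
  rw [e, le_div_iff₀ hc0]
  linarith

/-! ### Expansion around x = 1 and growth below the window -/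

/-- The binomial expansion of (v + a)^(σ+D), cut at order D in v. With a = φ and v = 1 - φ, the
first part only raises the power of φ, and the second is small near x = 1. -/
lemma one_eq_split {R : Type*} [CommRing R] {a v : R} (h : a + v = 1) (σ D : ℕ) :
    (1 : R) = a ^ σ * ∑ i ∈ range D, ((σ + D).choose i : R) * (v ^ i * a ^ (D - i))
      + v ^ D * ∑ i ∈ range (σ + 1), ((σ + D).choose (D + i) : R) * (v ^ i * a ^ (σ - i)) := by
  have h1 : (1 : R) = (v + a) ^ (σ + D) := by rw [add_comm, h, one_pow]
  rw [h1, add_pow, show σ + D + 1 = D + (σ + 1) by ring, sum_range_add, mul_sum, mul_sum]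
  congr 1
  · refine sum_congr rfl fun i hi => ?_
    have := mem_range.1 hi
    rw [show σ + D - i = σ + (D - i) by omega, pow_add]
    ring
  · refine sum_congr rfl fun i hi => ?_
    have := mem_range.1 hi
    rw [show σ + D - (D + i) = σ - i by omega, pow_add]
    ring

/-- With u = X - 1 this is the Taylor expansion of X^t at 1, cut at order D. The surplus tail terms
have vanishing binomial coefficients. -/
lemma add_one_pow_eq_split {R : Type*} [CommRing R] (u : R) (t D : ℕ) :
    (u + 1) ^ t = ∑ j ∈ range D, (t.choose j : R) * u ^ j
      + u ^ D * ∑ j ∈ range (t + 1), (t.choose (D + j) : R) * u ^ j := by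
  have h1 : (u + 1) ^ t = ∑ j ∈ range (t + 1 + D), (t.choose j : R) * u ^ j := by
    rw [add_pow, sum_range_add _ (t + 1) D, sum_eq_zero (s := range D)]
    · rw [add_zero]
      exact sum_congr rfl fun j _ => by rw [one_pow]; ring
    · intro j _
      rw [Nat.choose_eq_zero_of_lt (by omega)]
      simp
  rw [h1, add_comm (t + 1) D, sum_range_add, mul_sum]
  congr 1
  exact sum_congr rfl fun j _ => by rw [pow_add]; ring

lemma sum_choose_mul_two_pow_le (n M : ℕ) :
    ∑ i ∈ range M, (n.choose i : ℝ) * 2 ^ i ≤ 3 ^ n := by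
  have h : (3 : ℝ) ^ n = ∑ i ∈ range (n + 1 + M), (n.choose i : ℝ) * 2 ^ i := by
    rw [sum_range_add, sum_eq_zero (s := range M), add_zero,
      show (3 : ℝ) = 2 + 1 by norm_num, add_pow]
    · exact sum_congr rfl fun j _ => by rw [one_pow]; ring
    · intro j _
      rw [Nat.choose_eq_zero_of_lt (by omega)]
      simp
  rw [h]
  exact sum_le_sum_of_subset_of_nonneg (range_mono (by omega)) fun _ _ _ => by positivity

lemma sum_choose_add_mul_two_pow_le (n D M : ℕ) :
    ∑ i ∈ range M, (n.choose (D + i) : ℝ) * 2 ^ i ≤ 3 ^ n := by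
  refine le_trans ?_ (sum_choose_mul_two_pow_le n (D + M))
  rw [sum_range_add]
  have h1 : 0 ≤ ∑ i ∈ range D, (n.choose i : ℝ) * 2 ^ i := sum_nonneg fun _ _ => by positivity
  have h2 : ∑ i ∈ range M, (n.choose (D + i) : ℝ) * 2 ^ i
      ≤ ∑ i ∈ range M, (n.choose (D + i) : ℝ) * 2 ^ (D + i) := by
    refine sum_le_sum fun i _ => ?_
    gcongr
    · norm_num
    · omega
  linarith

lemma norm_sum_choose_mul_le {n D M : ℕ} {f : ℕ → ℂ}
    (hf : ∀ i ∈ range M, ‖f i‖ ≤ 2 ^ i) :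
    ‖∑ i ∈ range M, (n.choose (D + i) : ℂ) * f i‖ ≤ 3 ^ n := by
  refine (norm_sum_le _ _).trans (le_trans (sum_le_sum fun i hi => ?_)
    (sum_choose_add_mul_two_pow_le n D M))
  rw [norm_mul, Complex.norm_natCast]
  exact mul_le_mul_of_nonneg_left (hf i hi) (by positivity)

/-- Powers of `1 - φ` and `X - 1` cost at most a factor two each. -/
lemma abs_coeff_mul_pow_mul_pow_le {h φ : ℝ[X]} {k a₀ a₁ D : ℕ} {B : ℝ}
    (hB : ∀ a f, a₀ ≤ a → a ≤ a₁ → f ≤ D → |(h * φ ^ a * X ^ f).coeff k| ≤ B) (j : ℕ) :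
    ∀ i a f, a₀ ≤ a → a + i ≤ a₁ → f + j ≤ D →
      |(h * φ ^ a * X ^ f * (1 - φ) ^ i * (X - 1) ^ j).coeff k| ≤ 2 ^ (i + j) * B := by
  induction j with
  | zero =>
    intro i
    induction i with
    | zero =>
      intro a f ha ha' hf
      simpa using hB a f ha ha' hf
    | succ i ih =>
      intro a f ha ha' hf
      have e : h * φ ^ a * X ^ f * (1 - φ) ^ (i + 1) * (X - 1) ^ 0
          = h * φ ^ a * X ^ f * (1 - φ) ^ i * (X - 1) ^ 0
            - h * φ ^ (a + 1) * X ^ f * (1 - φ) ^ i * (X - 1) ^ 0 := by ring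
      rw [e, coeff_sub]
      have h1 := ih a f ha (by omega) hf
      have h2 := ih (a + 1) f (by omega) (by omega) hf
      refine (abs_sub _ _).trans ?_
      rw [add_zero] at h1 h2 ⊢
      rw [pow_succ (2 : ℝ)]
      linarith
  | succ j ih =>
    intro i a f ha ha' hf
    have e : h * φ ^ a * X ^ f * (1 - φ) ^ i * (X - 1) ^ (j + 1)
        = h * φ ^ a * X ^ (f + 1) * (1 - φ) ^ i * (X - 1) ^ j
          - h * φ ^ a * X ^ f * (1 - φ) ^ i * (X - 1) ^ j := by ring
    rw [e, coeff_sub]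
    have h1 := ih i a (f + 1) ha ha' (by omega)
    have h2 := ih i a f ha ha' (by omega)
    refine (abs_sub _ _).trans ?_
    rw [← add_assoc, pow_succ (2 : ℝ)]
    linarith

lemma choose_mul_two_pow_le {n i D : ℕ} {b : ℝ} (hi : i < D) (hn : (n : ℝ) ≤ b) (hb : 1 ≤ b) :
    (n.choose i : ℝ) * 2 ^ i ≤ (2 * b) ^ D := by
  calc (n.choose i : ℝ) * 2 ^ i ≤ (n : ℝ) ^ i * 2 ^ i := by
        gcongr
        exact_mod_cast Nat.choose_le_pow n i
    _ = (2 * n) ^ i := by ring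
    _ ≤ (2 * b) ^ i := by gcongr
    _ ≤ (2 * b) ^ D := pow_le_pow_right₀ (by linarith) hi.le

/-- The principal part: polynomial growth away from the window. -/
lemma abs_coeff_principal_le {d : ℕ} (hd : 1 ≤ d) {h φ : ℝ[X]} {k m s t D : ℕ} {B : ℝ}
    (hs : 2 * D ≤ s) (hsm : s ≤ m) (ht : t ≤ d * s)
    (hB : ∀ a f, m - 2 * D ≤ a → a ≤ m - D → f ≤ D → |(h * φ ^ a * X ^ f).coeff k| ≤ B) :
    |(h * φ ^ (m - s) * ((∑ j ∈ range D, (t.choose j : ℝ[X]) * (X - 1) ^ j) *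
      (φ ^ (s - 2 * D) * ∑ i ∈ range D, ((s - 2 * D + D).choose i : ℝ[X]) *
        ((1 - φ) ^ i * φ ^ (D - i))))).coeff k|
      ≤ D ^ 2 * (4 * d) ^ D * ((s : ℝ) + 1) ^ (2 * D) * B := by
  have hd1 : (1 : ℝ) ≤ d := by exact_mod_cast hd
  have hB0 : 0 ≤ B := (abs_nonneg _).trans (hB (m - D) 0 (by omega) (by omega) (by omega))
  -- The powers of φ combine to exponents m - 2D + (D - i); the factor (1 - φ)^i raises them to at
  -- most m - D, so only the window in `hB` is used.
  have e : h * φ ^ (m - s) * ((∑ j ∈ range D, (t.choose j : ℝ[X]) * (X - 1) ^ j) *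
      (φ ^ (s - 2 * D) * ∑ i ∈ range D, ((s - 2 * D + D).choose i : ℝ[X]) *
        ((1 - φ) ^ i * φ ^ (D - i))))
      = ∑ j ∈ range D, ∑ i ∈ range D, C ((t.choose j : ℝ) * ((s - 2 * D + D).choose i : ℝ)) *
        (h * φ ^ (m - 2 * D + (D - i)) * X ^ 0 * (1 - φ) ^ i * (X - 1) ^ j) := by
    have e1 : h * φ ^ (m - s) * ((∑ j ∈ range D, (t.choose j : ℝ[X]) * (X - 1) ^ j) *
      (φ ^ (s - 2 * D) * ∑ i ∈ range D, ((s - 2 * D + D).choose i : ℝ[X]) *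
        ((1 - φ) ^ i * φ ^ (D - i)))) = (h * φ ^ (m - s) * φ ^ (s - 2 * D)) *
        ((∑ j ∈ range D, (t.choose j : ℝ[X]) * (X - 1) ^ j) *
        ∑ i ∈ range D, ((s - 2 * D + D).choose i : ℝ[X]) * ((1 - φ) ^ i * φ ^ (D - i))) := by ring
    rw [e1, mul_assoc h, ← pow_add, show m - s + (s - 2 * D) = m - 2 * D by omega,
      sum_mul_sum, mul_sum]
    refine sum_congr rfl fun j _ => ?_
    rw [mul_sum]
    refine sum_congr rfl fun i _ => ?_
    rw [C_mul, C_eq_natCast, C_eq_natCast, pow_add]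
    ring
  rw [e, finsetSum_coeff]
  calc _ ≤ ∑ j ∈ range D, ∑ i ∈ range D,
        (2 * (d * ((s : ℝ) + 1))) ^ D * (2 * ((s : ℝ) + 1)) ^ D * B := by
        refine (abs_sum_le_sum_abs _ _).trans (sum_le_sum fun j hj => ?_)
        rw [finsetSum_coeff]
        refine (abs_sum_le_sum_abs _ _).trans (sum_le_sum fun i hi => ?_)
        have hj := mem_range.1 hj
        have hi := mem_range.1 hi
        have hW := abs_coeff_mul_pow_mul_pow_le hB j i (m - 2 * D + (D - i)) 0 (by omega)
          (by omega) (by omega)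
        rw [coeff_C_mul, abs_mul, abs_of_nonneg (by positivity)]
        have hts : (t : ℝ) ≤ d * ((s : ℝ) + 1) := by
          have : (t : ℝ) ≤ d * s := by exact_mod_cast ht
          linarith
        have hss : ((s - 2 * D + D : ℕ) : ℝ) ≤ (s : ℝ) + 1 := by
          exact_mod_cast (by omega : s - 2 * D + D ≤ s + 1)
        have hs1 : (1 : ℝ) ≤ (s : ℝ) + 1 := by linarith [(Nat.cast_nonneg s : (0 : ℝ) ≤ s)]
        have h1 := choose_mul_two_pow_le hj hts (by nlinarith)
        have h2 := choose_mul_two_pow_le hi hss hs1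
        calc _ ≤ (t.choose j : ℝ) * ((s - 2 * D + D).choose i : ℝ) * (2 ^ (i + j) * B) := by
              gcongr
          _ = ((t.choose j : ℝ) * 2 ^ j) * (((s - 2 * D + D).choose i : ℝ) * 2 ^ i) * B := by
              rw [pow_add]; ring
          _ ≤ _ := by gcongr
    _ = _ := by
        rw [sum_const, sum_const, card_range, nsmul_eq_mul, nsmul_eq_mul, pow_mul,
          mul_pow, mul_pow, mul_pow, mul_pow, pow_right_comm,
          show (4 : ℝ) = 2 * 2 by norm_num, mul_pow]
        ring

/-- A power of `X - 1` is beaten by a power of `φ` on the unit circle. -/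
lemma IsProb.norm_pow_mul_norm_aeval_pow_le {φ : ℝ[X]} {d : ℕ} (hd : 1 ≤ d) {ε : ℝ} (hε : 0 < ε)
    (hφ : IsProb φ d ε) {m s Q : ℕ} (hm : 0 < m) (hs : 2 * s ≤ m) {x : ℂ} (hx : ‖x‖ = 1) :
    ‖x - 1‖ ^ (2 * Q) * ‖aeval x φ‖ ^ (m - s) ≤ Q.factorial * (8 / ε) ^ Q / (m : ℝ) ^ Q := by
  have hm' : (0 : ℝ) < m := by exact_mod_cast hm
  -- The 8, in place of the 4 of `norm_aeval_pow_le_exp`, pays for m - s ≥ m/2.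
  set y := ε * ‖x - 1‖ ^ 2 / 8 * m with hy
  have hy0 : 0 ≤ y := by positivity
  have h1 : ‖aeval x φ‖ ^ (m - s) ≤ Real.exp (-y) := by
    refine (hφ.norm_aeval_pow_le_exp hd hε hx _).trans (Real.exp_le_exp.2 (neg_le_neg ?_))
    have h2 : (m : ℝ) ≤ 2 * (m - s : ℕ) := by exact_mod_cast (by omega : m ≤ 2 * (m - s))
    have : 0 ≤ ε * ‖x - 1‖ ^ 2 / 8 := by positivity
    nlinarith
  have h2 := Real.pow_div_factorial_le_exp y hy0 Q
  have hf : (0 : ℝ) < Q.factorial := by positivity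
  rw [div_le_iff₀ hf] at h2
  have h3 : ‖x - 1‖ ^ (2 * Q) = (8 / ε) ^ Q / (m : ℝ) ^ Q * y ^ Q := by
    rw [pow_mul, ← div_pow, ← mul_pow, hy]
    congr 1
    field_simp
  calc _ ≤ (8 / ε) ^ Q / (m : ℝ) ^ Q * (Real.exp y * Q.factorial) * Real.exp (-y) := by
        rw [h3]; gcongr
    _ = Q.factorial * (8 / ε) ^ Q / (m : ℝ) ^ Q * (Real.exp y * Real.exp (-y)) := by ring
    _ = _ := by rw [← Real.exp_add, add_neg_cancel, Real.exp_zero, mul_one]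

/-- Both `X ^ t` and 1 are replaced by their split forms. The product of the two principal parts
sees only window coefficients. Every other term has a factor of size |x - 1|^(2Q), because |1 - φ| ≤
d|x - 1|, and against φ^(m-s) this yields m^(-Q). The powers of 3 bound binomial sums in which |x -
1| and |1 - φ| are at most 2. -/
lemma IsProb.abs_coeff_le_principal_add_error {φ : ℝ[X]} {d : ℕ} (hd : 1 ≤ d) {ε : ℝ} (hε : 0 < ε)
    (hφ : IsProb φ d ε) {h : ℝ[X]} {k m s t Q J : ℕ} {B : ℝ} (hJ : h.natDegree ≤ J) (hm : 0 < m)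
    (hs : 2 * (2 * Q) ≤ s) (hsm : 2 * s ≤ m) (ht : t ≤ d * s)
    (hB : ∀ a f, m - 2 * (2 * Q) ≤ a → a ≤ m - 2 * Q → f ≤ 2 * Q →
      |(h * φ ^ a * X ^ f).coeff k| ≤ B) :
    |(h * φ ^ (m - s) * X ^ t).coeff k|
      ≤ (2 * Q : ℕ) ^ 2 * (4 * d) ^ (2 * Q) * ((s : ℝ) + 1) ^ (2 * (2 * Q)) * B
        + (∑ l ∈ range (J + 1), |h.coeff l|) * (2 * d ^ (2 * Q) * 3 ^ ((d + 1) * s)) *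
          (Q.factorial * (8 / ε) ^ Q / (m : ℝ) ^ Q) := by
  have hd1 : (1 : ℝ) ≤ d := by exact_mod_cast hd
  have hmain := abs_coeff_principal_le hd hs (by omega) ht hB
  set D := 2 * Q with hD
  set H := ∑ l ∈ range (J + 1), |h.coeff l| with hH
  have hH0 : 0 ≤ H := sum_nonneg fun _ _ => abs_nonneg _
  set σ := s - 2 * D with hσ
  set P := ∑ j ∈ range D, (t.choose j : ℝ[X]) * (X - 1) ^ j with hP
  set R := ∑ j ∈ range (t + 1), (t.choose (D + j) : ℝ[X]) * (X - 1) ^ j with hR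
  set A := ∑ i ∈ range D, ((σ + D).choose i : ℝ[X]) * ((1 - φ) ^ i * φ ^ (D - i)) with hA
  set E := ∑ i ∈ range (σ + 1), ((σ + D).choose (D + i) : ℝ[X]) * ((1 - φ) ^ i * φ ^ (σ - i))
    with hE
  have e1 : (1 : ℝ[X]) = φ ^ σ * A + (1 - φ) ^ D * E := one_eq_split (by ring) σ D
  have e2 : (X : ℝ[X]) ^ t = P + (X - 1) ^ D * R := by
    have := add_one_pow_eq_split (X - 1 : ℝ[X]) t D
    rwa [sub_add_cancel] at this
  have e3 : h * φ ^ (m - s) * X ^ t = h * φ ^ (m - s) * (P * (φ ^ σ * A)) +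
      h * φ ^ (m - s) * ((X - 1) ^ D * (R * (φ ^ σ * A)) + (1 - φ) ^ D * (X ^ t * E)) := by
    calc h * φ ^ (m - s) * X ^ t
        = h * φ ^ (m - s) * (X ^ t * (φ ^ σ * A + (1 - φ) ^ D * E)) := by rw [← e1, mul_one]
      _ = h * φ ^ (m - s) * ((P + (X - 1) ^ D * R) * (φ ^ σ * A) +
          X ^ t * ((1 - φ) ^ D * E)) := by rw [← e2]; ring
      _ = _ := by ring
  rw [e3, coeff_add]
  refine (abs_add_le _ _).trans (add_le_add hmain ?_)
  refine abs_coeff_le_of_norm_le (fun x hx => ?_) k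
  have hφ1 := hφ.norm_aeval_le_one hd hε hx
  have hu2 : ‖x - 1‖ ≤ 2 := (norm_sub_le _ _).trans (by rw [hx, norm_one]; norm_num)
  have hv2 : ‖1 - aeval x φ‖ ≤ 2 := (norm_sub_le _ _).trans (by rw [norm_one]; linarith)
  have hvu := hφ.norm_one_sub_aeval_le hε hx
  have hvi : ∀ i n : ℕ, ‖(1 - aeval x φ) ^ i * aeval x φ ^ n‖ ≤ 2 ^ i := by
    intro i n
    rw [norm_mul, norm_pow, norm_pow]
    have h1 : ‖1 - aeval x φ‖ ^ i ≤ 2 ^ i := by gcongr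
    have h2 : ‖aeval x φ‖ ^ n ≤ 1 := pow_le_one₀ (norm_nonneg _) hφ1
    calc _ ≤ (2 : ℝ) ^ i * 1 := by gcongr
      _ = 2 ^ i := mul_one _
  have hAn : ‖aeval x A‖ ≤ 3 ^ (σ + D) := by
    have := norm_sum_choose_mul_le (n := σ + D) (D := 0) (M := D)
      (f := fun i => (1 - aeval x φ) ^ i * aeval x φ ^ (D - i)) (fun i _ => hvi i _)
    simpa [hA] using this
  have hEn : ‖aeval x E‖ ≤ 3 ^ (σ + D) := by
    have := norm_sum_choose_mul_le (n := σ + D) (D := D) (M := σ + 1)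
      (f := fun i => (1 - aeval x φ) ^ i * aeval x φ ^ (σ - i)) (fun i _ => hvi i _)
    simpa [hE] using this
  have hRn : ‖aeval x R‖ ≤ 3 ^ t := by
    have := norm_sum_choose_mul_le (n := t) (D := D) (M := t + 1)
      (f := fun i => (x - 1) ^ i) (fun i _ => by rw [norm_pow]; gcongr)
    simpa [hR] using this
  have hsum : ‖aeval x ((X - 1) ^ D * (R * (φ ^ σ * A)) + (1 - φ) ^ D * (X ^ t * E))‖
      ≤ ‖x - 1‖ ^ D * (2 * d ^ D * 3 ^ ((d + 1) * s)) := by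
    simp only [map_add, map_mul, map_pow, map_sub, aeval_X, map_one]
    refine (norm_add_le _ _).trans ?_
    simp only [norm_mul, norm_pow, hx, one_pow, one_mul]
    have h1 : ‖aeval x φ‖ ^ σ ≤ 1 := pow_le_one₀ (norm_nonneg _) hφ1
    have h2 : (3 : ℝ) ^ t * 3 ^ (σ + D) ≤ 3 ^ ((d + 1) * s) := by
      rw [← pow_add]
      refine pow_le_pow_right₀ (by norm_num) ?_
      have : (d + 1) * s = d * s + s := by ring
      omega
    have h3 : (3 : ℝ) ^ (σ + D) ≤ 3 ^ ((d + 1) * s) :=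
      le_trans (le_mul_of_one_le_left (by positivity) (one_le_pow₀ (by norm_num))) h2
    have h4 : (1 : ℝ) ≤ (d : ℝ) ^ D := one_le_pow₀ hd1
    calc _ ≤ ‖x - 1‖ ^ D * (3 ^ t * (1 * 3 ^ (σ + D))) + (d * ‖x - 1‖) ^ D * 3 ^ (σ + D) := by
          gcongr
      _ = ‖x - 1‖ ^ D * (3 ^ t * 3 ^ (σ + D)) + ‖x - 1‖ ^ D * (d ^ D * 3 ^ (σ + D)) := by
          rw [mul_pow]; ring
      _ ≤ ‖x - 1‖ ^ D * (d ^ D * 3 ^ ((d + 1) * s)) + ‖x - 1‖ ^ D * (d ^ D * 3 ^ ((d + 1) * s)) := by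
          have h5 := h2.trans (le_mul_of_one_le_left (by positivity) h4)
          exact add_le_add (mul_le_mul_of_nonneg_left h5 (by positivity)) (by gcongr)
      _ = _ := by ring
  rw [map_mul, map_mul, map_pow, norm_mul, norm_mul, norm_pow]
  calc _ ≤ H * ‖aeval x φ‖ ^ (m - s) * (‖x - 1‖ ^ D * (2 * d ^ D * 3 ^ ((d + 1) * s))) := by
        gcongr
        exact norm_aeval_le_sum_abs hJ hx
    _ = H * (2 * d ^ D * 3 ^ ((d + 1) * s)) * (‖x - 1‖ ^ D * ‖aeval x φ‖ ^ (m - s)) := by ring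
    _ ≤ _ := by
        gcongr
        exact hφ.norm_pow_mul_norm_aeval_pow_le hd hε hm hsm hx

lemma exists_succ_pow_le_mul_pow (n : ℕ) {b : ℝ} (hb : 1 < b) :
    ∃ K : ℝ, 0 < K ∧ ∀ s : ℕ, ((s : ℝ) + 1) ^ n ≤ K * b ^ s := by
  have hb0 : 0 < b := by linarith
  obtain ⟨M, hM⟩ := (tendsto_pow_const_div_const_pow_of_one_lt n hb).bddAbove_range
  have hM' : ∀ s : ℕ, (s : ℝ) ^ n / b ^ s ≤ M := fun s => hM ⟨s, rfl⟩
  have hM1 : 0 < M := lt_of_lt_of_le (by positivity) (hM' 1)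
  refine ⟨M * b, by positivity, fun s => ?_⟩
  have := hM' (s + 1)
  rw [div_le_iff₀ (by positivity), pow_succ b] at this
  push_cast at this
  linarith

lemma exists_pow_le_pow (n : ℕ) {b : ℝ} (hb : 1 < b) :
    ∃ m₀ : ℕ, ∀ m : ℕ, m₀ ≤ m → (m : ℝ) ^ n ≤ b ^ m := by
  have h := (tendsto_pow_const_div_const_pow_of_one_lt n hb).eventually_le_const zero_lt_one
  obtain ⟨m₀, hm₀⟩ := Filter.eventually_atTop.1 h
  refine ⟨m₀, fun m hm => ?_⟩
  have := hm₀ m hm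
  have hb0 : 0 < b := by linarith
  rwa [div_le_one (by positivity)] at this

/-- If the coefficients of `h φ ^ m` are bounded in a fixed window near the saddle point, then
below the window they grow slower than any prescribed exponential. -/
theorem exists_abs_coeff_le_mul_pow {d : ℕ} (hd : 1 ≤ d) (N : ℕ) {ε b : ℝ} (hε : 0 < ε)
    (hb : 1 < b) :
    ∃ (S m₀ : ℕ) (K : ℝ), 0 < K ∧ ∀ (m k : ℕ) (φ h : ℝ[X]) (B : ℝ), m₀ ≤ m → IsProb φ d ε →
      ((m : ℝ) - N) * ∑ i ∈ range (d + 1), φ.coeff i * i = k - N * d → h.natDegree ≤ N * d →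
      (∀ s ≤ S, ∀ t ≤ d * s, |(h * φ ^ (m - s)).coeff (k - t)| ≤ B) →
      ∀ s ≤ m, ∀ t ≤ d * s, t ≤ k → |(h * φ ^ (m - s)).coeff (k - t)| ≤ K * b ^ s * B := by
  have hb0 : 0 < b := by linarith
  have hd1 : (1 : ℝ) ≤ d := by exact_mod_cast hd
  set J := N * d with hJdef
  obtain ⟨K₁, m₁, hK₁, hwin⟩ := sum_abs_coeff_le_of_window hd J hε
  -- E is the power of m lost in bounding h. When b^s < m^E, the choice of L gives 3^((d+1)s) ≤
  -- m^(EL), and Q = E + EL makes m^(-Q) cancel both factors.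
  set E := 2 * J + 1 with hE
  obtain ⟨L, hL⟩ := pow_unbounded_of_one_lt ((3 : ℝ) ^ (d + 1)) hb
  set Q := E * (L + 1) with hQ
  obtain ⟨K₂, hK₂, hpoly⟩ := exists_succ_pow_le_mul_pow (2 * (2 * Q)) hb
  obtain ⟨m₂, hm₂⟩ := exists_pow_le_pow (2 * E) hb
  obtain ⟨m₃, hm₃⟩ := exists_nat_ge ((2 * Q : ℕ) / ε : ℝ)
  set K₃ : ℝ := (2 * Q : ℕ) ^ 2 * (4 * d) ^ (2 * Q) * K₂ with hK₃
  set K₄ : ℝ := K₁ * (2 * d ^ (2 * Q)) * (Q.factorial * (8 / ε) ^ Q) with hK₄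
  have hK₃0 : 0 ≤ K₃ := by positivity
  have hK₄0 : 0 ≤ K₄ := by positivity
  -- The window must reach depth 4Q for the principal part and depth N for the estimate of h.
  refine ⟨2 * (2 * Q) + N, m₁ + N + m₂ + m₃ + 2 * (2 * Q) + 1, 1 + K₁ + K₃ + K₄, by positivity, ?_⟩
  intro m k φ h B hm hφ hmean hh hB s hsm t ht htk
  have hB0 : 0 ≤ B := (abs_nonneg _).trans (hB 0 (by omega) 0 (by omega))
  have hm1 : (1 : ℝ) ≤ m := by exact_mod_cast (by omega : 1 ≤ m)
  have hm0 : (0 : ℝ) < m := by linarith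
  have hbs : 1 ≤ b ^ s := one_le_pow₀ hb.le
  set μ := ∑ i ∈ range (d + 1), φ.coeff i * i with hμ
  have hμε : ε ≤ μ := by
    calc ε ≤ φ.coeff 1 * ((1 : ℕ) : ℝ) := by simpa using hφ.le_coeff 1 hd
      _ ≤ μ := single_le_sum (f := fun i : ℕ => φ.coeff i * (i : ℝ)) (fun i hi =>
        mul_nonneg (hε.le.trans (hφ.le_coeff i (by have := mem_range.1 hi; omega)))
          (Nat.cast_nonneg i)) (mem_range.2 (by omega))
  have hmN : ((m - N : ℕ) : ℝ) = m - N := by rw [Nat.cast_sub (by omega)]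
  -- This keeps the column subtractions `k - J` and `k - f` from being truncated at 0.
  have hkD : 2 * Q + J ≤ k := by
    have h1 : (m₃ : ℝ) ≤ (m : ℝ) - N := by
      rw [← hmN]; exact_mod_cast (by omega : m₃ ≤ m - N)
    rw [div_le_iff₀ hε] at hm₃
    have h2 : (m₃ : ℝ) * ε ≤ ((m : ℝ) - N) * μ :=
      mul_le_mul h1 hμε hε.le (by rw [← hmN]; positivity)
    have h3 : ((2 * Q : ℕ) : ℝ) + (N * d : ℕ) ≤ k := by push_cast at hm₃ ⊢; linarith
    rw [hJdef]
    exact_mod_cast h3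
  set H := ∑ l ∈ range (J + 1), |h.coeff l| with hH
  -- At depth N all shifts up to Nd = J are allowed, so the J + 1 columns ending at k are available
  -- there. Hence the mean is normalised by m - N and k - Nd.
  have hHle : H ≤ K₁ * (m : ℝ) ^ E * B := by
    have h1 : H ≤ K₁ * ((m - N : ℕ) : ℝ) ^ E * B := by
      refine hwin (m - N) (k - J) φ h B (by omega) hφ ?_ hh fun l hl => ?_
      · rw [hmN, Nat.cast_sub (by omega), hmean, hJdef]
        push_cast
        ring
      · have := hB N (by omega) (J - l) (by rw [mul_comm]; omega)
        rwa [show k - (J - l) = k - J + l by omega] at this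
    refine h1.trans ?_
    gcongr
    omega
  have hbB : 0 ≤ b ^ s * B := by positivity
  have e0 : (1 + K₁ + K₃ + K₄) * b ^ s * B
      = b ^ s * B + K₁ * (b ^ s * B) + K₃ * (b ^ s * B) + K₄ * (b ^ s * B) := by ring
  have p1 : 0 ≤ K₁ * (b ^ s * B) := by positivity
  have p3 : 0 ≤ K₃ * (b ^ s * B) := by positivity
  have p4 : 0 ≤ K₄ * (b ^ s * B) := by positivity
  have hBb : B ≤ b ^ s * B := le_mul_of_one_le_left hB0 hbs
  rw [e0]
  rcases le_or_gt ((m : ℝ) ^ E) (b ^ s) with hcase | hcase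
  · have h1 : |(h * φ ^ (m - s)).coeff (k - t)| ≤ H := by
      refine abs_coeff_le_of_norm_le (fun x hx => ?_) _
      rw [map_mul, map_pow, norm_mul, norm_pow]
      calc _ ≤ H * 1 := by
            gcongr
            · exact norm_aeval_le_sum_abs hh hx
            · exact pow_le_one₀ (norm_nonneg _) (hφ.norm_aeval_le_one hd hε hx)
        _ = H := mul_one _
    have h2 : K₁ * (m : ℝ) ^ E * B ≤ K₁ * (b ^ s * B) := by
      rw [mul_assoc]; gcongr
    linarith
  rcases le_or_gt s (2 * (2 * Q)) with hs | hs
  · have := hB s (by omega) t ht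
    linarith
  -- Otherwise b^m ≤ b^(2s) < m^(2E), which is false for large m.
  have hsm2 : 2 * s ≤ m := by
    by_contra hcon
    have h1 : b ^ m ≤ b ^ (2 * s) := pow_le_pow_right₀ hb.le (by omega)
    have h2 : b ^ (2 * s) < (m : ℝ) ^ (2 * E) := by
      rw [mul_comm 2 s, mul_comm 2 E, pow_mul, pow_mul]
      exact pow_lt_pow_left₀ hcase (by positivity) two_ne_zero
    exact absurd (hm₂ m (by omega)) (not_le.2 (h1.trans_lt h2))
  have hX := hφ.abs_coeff_le_principal_add_error hd hε (k := k) (t := t) (Q := Q) (B := B) hh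
    (by omega : 0 < m) hs.le hsm2 ht ?_
  · rw [coeff_mul_X_pow', if_pos htk] at hX
    have h1 : (2 * Q : ℕ) ^ 2 * (4 * d) ^ (2 * Q) * ((s : ℝ) + 1) ^ (2 * (2 * Q)) * B
        ≤ K₃ * (b ^ s * B) := by
      calc _ ≤ (2 * Q : ℕ) ^ 2 * (4 * d) ^ (2 * Q) * (K₂ * b ^ s) * B := by
            gcongr
            exact hpoly s
        _ = _ := by rw [hK₃]; ring
    have h3 : (3 : ℝ) ^ ((d + 1) * s) ≤ (m : ℝ) ^ (E * L) := by
      calc (3 : ℝ) ^ ((d + 1) * s) = (3 ^ (d + 1)) ^ s := by rw [pow_mul]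
        _ ≤ (b ^ L) ^ s := by gcongr
        _ = (b ^ s) ^ L := by rw [← pow_mul, ← pow_mul, mul_comm]
        _ ≤ ((m : ℝ) ^ E) ^ L := by gcongr
        _ = _ := by rw [pow_mul]
    have h2 : H * (2 * d ^ (2 * Q) * 3 ^ ((d + 1) * s)) * (Q.factorial * (8 / ε) ^ Q / (m : ℝ) ^ Q)
        ≤ K₄ * (b ^ s * B) := by
      calc _ ≤ (K₁ * (m : ℝ) ^ E * B) * (2 * d ^ (2 * Q) * (m : ℝ) ^ (E * L)) *
            (Q.factorial * (8 / ε) ^ Q / (m : ℝ) ^ Q) := by gcongr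
        _ = K₄ * B * ((m : ℝ) ^ E * (m : ℝ) ^ (E * L) / (m : ℝ) ^ Q) := by rw [hK₄]; ring
        _ = K₄ * B := by
            rw [← pow_add, show E + E * L = Q by rw [hQ]; ring, div_self (by positivity), mul_one]
        _ ≤ _ := by gcongr
    linarith
  · intro a f ha ha' hf
    rw [coeff_mul_X_pow', if_pos (by omega)]
    have := hB (m - a) (by omega) f (by nlinarith [Nat.mul_le_mul hd (le_refl (m - a)), (by omega : 2 * Q ≤ m - a)])
    rwa [show m - (m - a) = a by omega] at this

/-- For s > s₁, half of the decay rate absorbs K. For s ≤ s₁, C s ≤ 1/3 gives 3e^(-Cs) ≥ 3(1 - 1/3)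
= 2, which explains the constant 3. -/
lemma exists_rate_of_le_mul_pow (K : ℝ) {b : ℝ} (hb : 1 < b) :
    ∃ C : ℝ, 0 < C ∧ ∀ (s : ℕ) (g : ℝ), g ≤ 2 → g ≤ K * (b⁻¹) ^ s →
      g ≤ 3 * Real.exp (-C * s) := by
  have hb0 : 0 < b := by linarith
  have hc : 0 < Real.log b := Real.log_pos hb
  set c := Real.log b with hcdef
  obtain ⟨s₁, hs₁⟩ := exists_nat_ge (2 * K / c)
  rw [div_le_iff₀ hc] at hs₁
  refine ⟨min (c / 2) (1 / (3 * (s₁ + 1))), by positivity, fun s g hg2 hg => ?_⟩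
  set C := min (c / 2) (1 / (3 * ((s₁ : ℝ) + 1))) with hC
  rcases le_or_gt s s₁ with h | h
  · have h1 : C * s ≤ 1 / 3 := by
      have : (s : ℝ) ≤ s₁ + 1 := by exact_mod_cast (by omega : s ≤ s₁ + 1)
      calc C * s ≤ 1 / (3 * ((s₁ : ℝ) + 1)) * (s₁ + 1) := by
            gcongr
            exact min_le_right _ _
        _ = 1 / 3 := by field_simp
    have := Real.add_one_le_exp (-C * s)
    linarith
  · have hbe : (b⁻¹) ^ s = Real.exp (-(c * s)) := by
      rw [mul_comm, ← mul_neg, Real.exp_nat_mul, Real.exp_neg, hcdef, Real.exp_log hb0]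
    have hs : (s₁ : ℝ) ≤ s := by exact_mod_cast h.le
    have h1 : K ≤ Real.exp (c / 2 * s) := by
      have := Real.add_one_le_exp (c / 2 * s)
      nlinarith
    calc g ≤ Real.exp (c / 2 * s) * Real.exp (-(c * s)) := by
          refine hg.trans ?_
          rw [hbe]
          gcongr
      _ = Real.exp (-(c / 2) * s) := by rw [← Real.exp_add]; congr 1; ring
      _ ≤ Real.exp (-C * s) := by
          gcongr
          exact min_le_left _ _
      _ ≤ 3 * Real.exp (-C * s) := by linarith [Real.exp_pos (-C * s)]

/-! ### Exponential tilting and the saddle point -/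

/-- The value at `r` of a polynomial with natural coefficients. -/
noncomputable def massAt (p : ℕ[X]) (r : ℝ) : ℝ :=
  ∑ i ∈ range (p.natDegree + 1), (p.coeff i : ℝ) * r ^ i

/-- The polynomial `p(r x) / p(r)`. -/
noncomputable def tilt (p : ℕ[X]) (r : ℝ) : ℝ[X] :=
  C (massAt p r)⁻¹ * (p.map (Nat.castRingHom ℝ)).comp (C r * X)

/-- The polynomial `∑ α_l r ^ l x ^ l / R`. -/
noncomputable def tiltWeight (J : ℕ) (α : ℕ → ℝ) (R r : ℝ) : ℝ[X] :=
  ∑ l ∈ range (J + 1), C (α l * r ^ l / R) * X ^ l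

lemma coeff_tilt_pow (p : ℕ[X]) (r : ℝ) (n k : ℕ) :
    (tilt p r ^ n).coeff k = ((massAt p r)⁻¹) ^ n * (((p ^ n).coeff k : ℝ) * r ^ k) := by
  rw [tilt, mul_pow, ← C_pow, coeff_C_mul, ← pow_comp, ← Polynomial.map_pow,
    comp_C_mul_X_coeff, coeff_map]
  rfl

lemma coeff_tilt (p : ℕ[X]) (r : ℝ) (k : ℕ) :
    (tilt p r).coeff k = (massAt p r)⁻¹ * ((p.coeff k : ℝ) * r ^ k) := by
  simpa using coeff_tilt_pow p r 1 k

lemma natDegree_tiltWeight_le (J : ℕ) (α : ℕ → ℝ) (R r : ℝ) :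
    (tiltWeight J α R r).natDegree ≤ J := by
  refine natDegree_sum_le_of_forall_le _ _ fun l hl => (natDegree_C_mul_X_pow_le _ _).trans ?_
  have := mem_range.1 hl
  omega

lemma coeff_tiltWeight_mul_tilt_pow (p : ℕ[X]) (N : ℕ) (α : ℕ → ℝ) (R r : ℝ) (n k : ℕ) :
    (tiltWeight (N * p.natDegree) α R r * tilt p r ^ (n - N)).coeff k
      = r ^ k * ((massAt p r)⁻¹) ^ (n - N) * gam p N α R n k := by
  rw [tiltWeight, sum_mul, finsetSum_coeff, gam, mul_sum, mul_sum]
  refine sum_congr rfl fun l _ => ?_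
  rw [mul_assoc, coeff_C_mul, X_pow_mul, coeff_mul_X_pow', genBinom]
  by_cases h : l ≤ k
  · rw [if_pos h, if_pos (by omega), coeff_tilt_pow, show ((k : ℤ) - l).toNat = k - l by omega]
    have : r ^ k = r ^ l * r ^ (k - l) := by rw [← pow_add]; congr 1; omega
    rw [this]
    ring
  · rw [if_neg h, if_neg (by omega)]
    simp

namespace IsGenerating

variable {p : ℕ[X]}

lemma one_le_coeff (hp : IsGenerating p) {i : ℕ} (hi : i ≤ p.natDegree) : (1 : ℝ) ≤ p.coeff i := by
  exact_mod_cast hp.coeff_pos i hi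

lemma massAt_pos (hp : IsGenerating p) {r : ℝ} (hr : 0 < r) : 0 < massAt p r := by
  refine sum_pos (fun i hi => ?_) ⟨0, mem_range.2 (by omega)⟩
  have := hp.one_le_coeff (i := i) (by have := mem_range.1 hi; omega)
  positivity

lemma one_le_massAt_one (hp : IsGenerating p) : 1 ≤ massAt p 1 := by
  have h := single_le_sum (f := fun i => (p.coeff i : ℝ) * 1 ^ i)
    (fun i _ => by positivity) (mem_range.2 (by omega : 0 < p.natDegree + 1))
  have := hp.one_le_coeff (i := 0) (by omega)
  unfold massAt
  simp only [one_pow, mul_one] at h ⊢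
  linarith

lemma massAt_le {r ρ : ℝ} (hρ : 0 < ρ) (hρ1 : ρ ≤ 1) (hr0 : 0 ≤ r) (hr : r ≤ ρ⁻¹) :
    massAt p r ≤ massAt p 1 * (ρ⁻¹) ^ p.natDegree := by
  unfold massAt
  rw [sum_mul]
  refine sum_le_sum fun i hi => ?_
  rw [one_pow, mul_one]
  refine mul_le_mul_of_nonneg_left ?_ (by positivity)
  calc r ^ i ≤ (ρ⁻¹) ^ i := by gcongr
    _ ≤ _ := pow_le_pow_right₀ ((one_le_inv₀ hρ).2 hρ1) (by have := mem_range.1 hi; omega)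

/-- The lower bound on the coefficients is independent of r in [ρ, ρ⁻¹]; this makes all later
constants independent of the apex. -/
lemma isProb_tilt (hp : IsGenerating p) {r ρ : ℝ} (hρ : 0 < ρ) (hρ1 : ρ ≤ 1) (hr0 : ρ ≤ r)
    (hr : r ≤ ρ⁻¹) :
    IsProb (tilt p r) p.natDegree
      ((massAt p 1 * (ρ⁻¹) ^ p.natDegree)⁻¹ * ρ ^ p.natDegree) where
  natDegree_le := by
    refine (natDegree_C_mul_le _ _).trans (natDegree_comp_le.trans ?_)
    calc _ ≤ p.natDegree * 1 := Nat.mul_le_mul natDegree_map_le ((natDegree_C_mul_le r X).trans natDegree_X_le)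
      _ = _ := mul_one _
  le_coeff := by
    intro i hi
    rw [coeff_tilt]
    have h1 := hp.massAt_pos (hρ.trans_le hr0)
    have h2 := massAt_le (p := p) hρ hρ1 (hρ.le.trans hr0) hr
    have h3 := hp.one_le_coeff hi
    gcongr
    calc ρ ^ p.natDegree ≤ ρ ^ i := pow_le_pow_of_le_one hρ.le hρ1 hi
      _ ≤ r ^ i := by gcongr
      _ ≤ _ := le_mul_of_one_le_left (pow_nonneg (hρ.le.trans hr0) _) h3
  sum_coeff := by
    simp only [coeff_tilt]
    rw [← mul_sum]
    exact inv_mul_cancel₀ (hp.massAt_pos (hρ.trans_le hr0)).ne'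

/-- The source of the exponential decay. If r ≤ 1, then r^t ≤ 1 and p(r) ≥ 1 + r ≥ 1 + ρ. If r ≥ 1,
then r^t ≤ r^(ds) and p(r) ≥ r^d + r^(d-1) ≥ r^d (1 + ρ). -/
lemma pow_mul_one_add_pow_le (hp : IsGenerating p) {r ρ : ℝ} (hρ : 0 < ρ) (hr0 : ρ ≤ r)
    (hr : r ≤ ρ⁻¹) {s t : ℕ} (ht : t ≤ p.natDegree * s) :
    r ^ t * (1 + ρ) ^ s ≤ massAt p r ^ s := by
  have hr00 : 0 < r := hρ.trans_le hr0
  obtain ⟨e, he⟩ : ∃ e, p.natDegree = e + 1 := ⟨p.natDegree - 1, by have := hp.1; omega⟩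
  have hterm : ∀ i ≤ e + 1, r ^ i ≤ (p.coeff i : ℝ) * r ^ i := fun i hi =>
    le_mul_of_one_le_left (pow_nonneg hr00.le _) (hp.one_le_coeff (by omega))
  have hpos : ∀ s : ℕ → ℕ, ∀ n, 0 ≤ ∑ i ∈ range n, (p.coeff (s i) : ℝ) * r ^ (s i) :=
    fun s n => sum_nonneg fun _ _ => by positivity
  rcases le_total r 1 with h | h
  · have h1 : 1 + ρ ≤ massAt p r := by
      unfold massAt
      rw [he, sum_range_succ', sum_range_succ']
      have a0 := hterm 0 (by omega)
      have a1 := hterm (0 + 1) (by omega)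
      have := hpos (fun i => i + 1 + 1) e
      simp only [zero_add, pow_zero, pow_one] at *
      linarith
    calc _ ≤ 1 * massAt p r ^ s := by
          gcongr
          exact pow_le_one₀ hr00.le h
      _ = _ := one_mul _
  · have h1 : r ^ p.natDegree * (1 + ρ) ≤ massAt p r := by
      unfold massAt
      rw [he, sum_range_succ, sum_range_succ]
      have a0 := hterm e (by omega)
      have a1 := hterm (e + 1) (by omega)
      have := hpos (fun i => i) e
      have h2 : r * ρ ≤ 1 := by
        calc r * ρ ≤ ρ⁻¹ * ρ := by gcongr
          _ = 1 := inv_mul_cancel₀ hρ.ne'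
      have h3 : r ^ (e + 1) * ρ ≤ r ^ e := by
        rw [pow_succ, mul_assoc]
        exact mul_le_of_le_one_right (by positivity) h2
      linarith
    calc r ^ t * (1 + ρ) ^ s ≤ r ^ (p.natDegree * s) * (1 + ρ) ^ s := by
          gcongr
      _ = (r ^ p.natDegree * (1 + ρ)) ^ s := by rw [mul_pow, pow_mul]
      _ ≤ _ := by gcongr

/-- Existence of the saddle point, with explicit bounds. -/
lemma exists_saddle (hp : IsGenerating p) {δ κ ρ : ℝ} (hδ : 0 < δ) (hδ1 : δ ≤ 1)
    (hρ : ρ = δ / (p.natDegree * massAt p 1)) (h1 : δ ≤ κ) (h2 : κ ≤ p.natDegree - δ) :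
    ∃ r, ρ ≤ r ∧ r ≤ ρ⁻¹ ∧
      ∑ i ∈ range (p.natDegree + 1), (p.coeff i : ℝ) * r ^ i * i = κ * massAt p r := by
  have hS := hp.one_le_massAt_one
  have hd : (1 : ℝ) ≤ p.natDegree := by exact_mod_cast hp.1
  set d := p.natDegree with hddef
  set S := massAt p 1 with hSdef
  have hdS : (1 : ℝ) ≤ d * S := by nlinarith
  have hρ0 : 0 < ρ := by rw [hρ]; positivity
  have hρ1 : ρ ≤ 1 := by rw [hρ, div_le_one (by positivity)]; linarith
  have hρS : d * S * ρ = δ := by rw [hρ]; field_simp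
  have hSsum : ∑ i ∈ range (d + 1), (p.coeff i : ℝ) = S := by
    rw [hSdef, massAt, ← hddef]; simp
  -- The saddle equation is G = 0. As dSρ = δ, the first moment at ρ is at most δ ≤ κ ≤ κ p(ρ), so
  -- G(ρ) ≤ 0; multiplying by ρ^d reverses the coefficients and gives G(ρ⁻¹) ≥ 0 in the same way.
  set G : ℝ → ℝ := fun r => ∑ i ∈ range (d + 1), (p.coeff i : ℝ) * r ^ i * (i - κ) with hG
  have hGc : Continuous G := by fun_prop
  have hGeq : ∀ r, G r = ∑ i ∈ range (d + 1), (p.coeff i : ℝ) * r ^ i * i - κ * massAt p r := by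
    intro r
    simp only [hG, mul_sub, sum_sub_distrib]
    rw [← sum_mul, mul_comm κ]
    rfl
  have hlow : G ρ ≤ 0 := by
    have e1 : ∑ i ∈ range (d + 1), (p.coeff i : ℝ) * ρ ^ i * i ≤ δ := by
      rw [← hρS, mul_comm (d : ℝ), ← hSsum, sum_mul, sum_mul]
      refine sum_le_sum fun i hi => ?_
      have hi : (i : ℝ) ≤ d := by have := mem_range.1 hi; exact_mod_cast (by omega : i ≤ d)
      rcases Nat.eq_zero_or_pos i with h0 | h0
      · subst h0; simp; positivity
      · have : ρ ^ i ≤ ρ := by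
          simpa using pow_le_pow_of_le_one hρ0.le hρ1 h0
        calc (p.coeff i : ℝ) * ρ ^ i * i ≤ (p.coeff i : ℝ) * ρ * d := by gcongr
          _ = _ := by ring
    have e2 : 1 ≤ massAt p ρ := by
      have h := single_le_sum (f := fun i => (p.coeff i : ℝ) * ρ ^ i)
        (fun i _ => by positivity) (mem_range.2 (by omega : 0 < d + 1))
      have := hp.one_le_coeff (i := 0) (by omega)
      simp only [pow_zero, mul_one] at h
      exact this.trans h
    rw [hGeq]
    nlinarith
  have hhigh : 0 ≤ G ρ⁻¹ := by
    have e0 : ρ ^ d * G ρ⁻¹ = ∑ i ∈ range (d + 1), (p.coeff i : ℝ) * ρ ^ (d - i) * (i - κ) := by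
      simp only [hG]
      rw [mul_sum]
      refine sum_congr rfl fun i hi => ?_
      have hi : i ≤ d := by have := mem_range.1 hi; omega
      have : ρ ^ d * (ρ⁻¹) ^ i = ρ ^ (d - i) := by
        rw [inv_pow, ← div_eq_mul_inv, pow_sub₀ _ hρ0.ne' hi, div_eq_mul_inv]
      rw [← this]; ring
    have e1 : ∑ i ∈ range (d + 1), (p.coeff i : ℝ) * ρ ^ (d - i) * ((d : ℝ) - i) ≤ δ := by
      rw [← hρS, mul_comm (d : ℝ), ← hSsum, sum_mul, sum_mul]
      refine sum_le_sum fun i hi => ?_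
      have hi : i ≤ d := by have := mem_range.1 hi; omega
      rcases hi.eq_or_lt with h0 | h0
      · rw [h0]; simp; positivity
      · have h3 : ρ ^ (d - i) ≤ ρ := by
          simpa using pow_le_pow_of_le_one hρ0.le hρ1 (by omega : 1 ≤ d - i)
        have h4 : (d : ℝ) - i ≤ d := by linarith [(Nat.cast_nonneg i : (0 : ℝ) ≤ i)]
        have h5 : (0 : ℝ) ≤ (d : ℝ) - i := sub_nonneg.2 (by exact_mod_cast hi)
        calc (p.coeff i : ℝ) * ρ ^ (d - i) * ((d : ℝ) - i) ≤ (p.coeff i : ℝ) * ρ * d := by gcongr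
          _ = _ := by ring
    have e2 : 1 ≤ ∑ i ∈ range (d + 1), (p.coeff i : ℝ) * ρ ^ (d - i) := by
      have h := single_le_sum (f := fun i => (p.coeff i : ℝ) * ρ ^ (d - i))
        (fun i _ => by positivity) (mem_range.2 (by omega : d < d + 1))
      have := hp.one_le_coeff (i := d) le_rfl
      simp only [Nat.sub_self, pow_zero, mul_one] at h
      exact this.trans h
    have e3 : ρ ^ d * G ρ⁻¹ = (d - κ) * ∑ i ∈ range (d + 1), (p.coeff i : ℝ) * ρ ^ (d - i)
        - ∑ i ∈ range (d + 1), (p.coeff i : ℝ) * ρ ^ (d - i) * ((d : ℝ) - i) := by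
      rw [e0, mul_sum, ← sum_sub_distrib]
      exact sum_congr rfl fun i _ => by ring
    have e4 : 0 ≤ ρ ^ d * G ρ⁻¹ := by
      rw [e3]; nlinarith
    exact nonneg_of_mul_nonneg_right e4 (by positivity)
  have hle : ρ ≤ ρ⁻¹ := hρ1.trans ((one_le_inv₀ hρ0).2 hρ1)
  obtain ⟨r, hr, hr0⟩ := intermediate_value_Icc hle hGc.continuousOn ⟨hlow, hhigh⟩
  refine ⟨r, hr.1, hr.2, ?_⟩
  rw [hGeq] at hr0
  linarith

end IsGenerating

/-! ### Transfer between γ and tilted coefficients, and conclusion -/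

lemma isBelow_sub_sub {d N n' k' S s t : ℕ} (hN : N + S ≤ n') (hk : d * S ≤ k')
    (hk' : k' + d * S ≤ n' * d) (hs : s ≤ S) (ht : t ≤ d * s) :
    IsBelow d N n' k' (n' - s) (k' - t) := by
  have h1 : d * s ≤ d * S := Nat.mul_le_mul le_rfl hs
  have h2 : ((n' - s : ℕ) : ℤ) = n' - s := by omega
  have h3 : ((k' - t : ℕ) : ℤ) = k' - t := by omega
  have h4 : (k' : ℤ) + d * S ≤ n' * d := by exact_mod_cast hk'
  have h5 : (t : ℤ) ≤ d * s := by exact_mod_cast ht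
  have h6 : (d : ℤ) * s ≤ d * S := by exact_mod_cast h1
  have h7 : (0 : ℤ) ≤ t := by positivity
  refine ⟨⟨by omega, by omega⟩, by omega, ?_, ?_⟩
  · rw [h2, h3]; linarith
  · rw [h2, h3]; linarith

/-- Undoing the exponential tilt. -/
lemma le_mul_inv_pow_of_tilted_le {r P ρ b K M x : ℝ} {m k s t : ℕ} (hr : 0 < r) (hP : 0 < P)
    (hρ : 0 < ρ) (hb : b ^ 2 = 1 + ρ) (hb0 : 0 < b) (hK : 0 ≤ K) (hM : 0 ≤ M) (hsm : s ≤ m)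
    (htk : t ≤ k)
    (hgrow : r ^ t * (1 + ρ) ^ s ≤ P ^ s)
    (h : r ^ (k - t) * (P⁻¹) ^ (m - s) * x ≤ K * b ^ s * (r ^ k * (P⁻¹) ^ m * M)) :
    x ≤ K * M * (b⁻¹) ^ s := by
  have e1 : r ^ k = r ^ (k - t) * r ^ t := by rw [← pow_add]; congr 1; omega
  have e2 : (P⁻¹) ^ m = (P⁻¹) ^ (m - s) * (P⁻¹) ^ s := by rw [← pow_add]; congr 1; omega
  have hpos : 0 < r ^ (k - t) * (P⁻¹) ^ (m - s) := by positivity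
  have h1 : x ≤ K * b ^ s * (r ^ t * (P⁻¹) ^ s * M) := by
    refine le_of_mul_le_mul_left (h.trans_eq ?_) hpos
    rw [e1, e2]; ring
  have h2 : r ^ t * (P⁻¹) ^ s ≤ ((1 + ρ) ^ s)⁻¹ := by
    rw [inv_pow, ← div_eq_mul_inv, div_le_iff₀ (by positivity), ← div_eq_inv_mul,
      le_div_iff₀ (by positivity)]
    exact hgrow
  calc x ≤ K * b ^ s * (((1 + ρ) ^ s)⁻¹ * M) := by
        refine h1.trans ?_
        gcongr
    _ = K * M * (b⁻¹) ^ s := by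
        rw [← hb, pow_right_comm, sq, inv_pow]
        field_simp

/-- In a bounded window the tilt costs at most a constant factor. -/
lemma tilted_le_of_le {r P ρ A x : ℝ} {m k s t d S : ℕ} (hP : 0 < P) (hρ : 0 < ρ)
    (hρ1 : ρ ≤ 1) (hr : ρ ≤ r) (hPA : P ≤ A) (hA : 1 ≤ A) (hsm : s ≤ m) (htk : t ≤ k)
    (hs : s ≤ S) (ht : t ≤ d * s) (hx : x ≤ 2) :
    r ^ (k - t) * (P⁻¹) ^ (m - s) * x ≤
      r ^ k * (P⁻¹) ^ m * (2 * ((ρ⁻¹) ^ (d * S) * A ^ S)) := by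
  have hr0 : 0 < r := hρ.trans_le hr
  have e1 : r ^ k = r ^ (k - t) * r ^ t := by rw [← pow_add]; congr 1; omega
  have e2 : (P⁻¹) ^ m = (P⁻¹) ^ (m - s) * (P⁻¹) ^ s := by rw [← pow_add]; congr 1; omega
  have h1 : 1 ≤ r ^ t * (ρ⁻¹) ^ (d * S) := by
    have : t ≤ d * S := ht.trans (Nat.mul_le_mul le_rfl hs)
    calc (1 : ℝ) = ρ ^ t * (ρ⁻¹) ^ t := by rw [← mul_pow, mul_inv_cancel₀ hρ.ne', one_pow]
      _ ≤ r ^ t * (ρ⁻¹) ^ (d * S) := by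
          gcongr
          exact (one_le_inv₀ hρ).2 hρ1
  have h2 : 1 ≤ (P⁻¹) ^ s * A ^ S := by
    calc (1 : ℝ) = (P⁻¹) ^ s * P ^ s := by rw [← mul_pow, inv_mul_cancel₀ hP.ne', one_pow]
      _ ≤ (P⁻¹) ^ s * A ^ S := by
          gcongr
          calc P ^ s ≤ A ^ s := by gcongr
            _ ≤ A ^ S := pow_le_pow_right₀ hA hs
  calc r ^ (k - t) * (P⁻¹) ^ (m - s) * x ≤ r ^ (k - t) * (P⁻¹) ^ (m - s) * (2 * (1 * 1)) := by
        gcongr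
        linarith
    _ ≤ r ^ (k - t) * (P⁻¹) ^ (m - s) *
        (2 * ((r ^ t * (ρ⁻¹) ^ (d * S)) * ((P⁻¹) ^ s * A ^ S))) := by gcongr
    _ = _ := by rw [e1, e2]; ring

end PolyAdic

theorem mainTheorem9 (p : Polynomial ℕ) (hp : PolyAdic.IsGenerating p)
    (N : ℕ) (hN : 1 ≤ N) (δ : ℝ) (hδ0 : 0 < δ) (hδ1 : δ < 1 / 4) :
    ∃ C : ℝ, 0 < C ∧ ∃ n₀ : ℕ, ∀ n' k' : ℕ, n₀ ≤ n' →
      PolyAdic.IsSeparated p.natDegree δ n' k' →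
      ∀ α : ℕ → ℝ, 0 < ∑ l ∈ Finset.range (N * p.natDegree + 1), α l ^ 2 →
      ∀ R : ℝ, R ≠ 0 →
      (∀ n k : ℕ, PolyAdic.IsBelow p.natDegree N n' k' n k →
        |PolyAdic.gam p N α R n k| ≤ 2) →
      ∀ n k : ℕ, PolyAdic.IsBelow p.natDegree N n' k' n k →
        |PolyAdic.gam p N α R n k| ≤ 3 * Real.exp (-C * ((n' : ℝ) - (n : ℝ))) := by
  have hS := hp.one_le_massAt_one
  have hd : (1 : ℝ) ≤ p.natDegree := by exact_mod_cast hp.1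
  set d := p.natDegree with hddef
  obtain ⟨ρ, hρ⟩ : ∃ ρ, ρ = δ / (d * PolyAdic.massAt p 1) := ⟨_, rfl⟩
  have hdS : (1 : ℝ) ≤ d * PolyAdic.massAt p 1 := by nlinarith
  have hρ0 : 0 < ρ := by rw [hρ]; positivity
  have hρ1 : ρ ≤ 1 := by rw [hρ, div_le_one (by positivity)]; linarith
  have hρi : 1 ≤ ρ⁻¹ := (one_le_inv₀ hρ0).2 hρ1
  set A := PolyAdic.massAt p 1 * (ρ⁻¹) ^ d with hA
  have hA1 : 1 ≤ A := by
    have := one_le_pow₀ hρi (n := d)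
    nlinarith
  -- The tilt gains (1 + ρ)^(-s) = b^(-2s) and the growth theorem loses b^s, leaving b^(-s).
  set b := √(1 + ρ) with hbdef
  have hb2 : b ^ 2 = 1 + ρ := Real.sq_sqrt (by linarith)
  have hb : 1 < b := by rw [hbdef, Real.lt_sqrt (by norm_num)]; linarith
  obtain ⟨S, m₀, K, hK, hcore⟩ := PolyAdic.exists_abs_coeff_le_mul_pow hp.1 N
    (ε := A⁻¹ * ρ ^ d) (by positivity) hb
  set M := 2 * ((ρ⁻¹) ^ (d * S) * A ^ S) with hM
  have hM0 : 0 ≤ M := by positivity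
  obtain ⟨C, hC, hrate⟩ := PolyAdic.exists_rate_of_le_mul_pow (K * M) hb
  obtain ⟨n₁, hn₁⟩ := exists_nat_ge ((2 * N * d + d * S) / δ : ℝ)
  rw [div_le_iff₀ hδ0] at hn₁
  refine ⟨C, hC, n₁ + m₀ + 2 * N + S + 1, ?_⟩
  intro n' k' hn' hsep α _ R _ hbound n k hbelow
  obtain ⟨⟨hs1, hs2⟩, hs3, -⟩ := hsep
  have hn1' : (n₁ : ℝ) ≤ n' := by exact_mod_cast (by omega : n₁ ≤ n')
  have hδn : 2 * N * d + d * S ≤ δ * n' := by nlinarith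
  have hdSn : (0 : ℝ) ≤ d * S := by positivity
  have hNd : (0 : ℝ) ≤ N * d := by positivity
  have hδn0 : 0 ≤ δ * n' := by positivity
  have hkS : d * S ≤ k' := by
    have : ((d * S : ℕ) : ℝ) ≤ k' := by push_cast; linarith
    exact_mod_cast this
  have hkS' : k' + d * S ≤ n' * d := by
    have : ((k' + d * S : ℕ) : ℝ) ≤ (n' * d : ℕ) := by push_cast; linarith
    exact_mod_cast this
  have hm2 : (0 : ℝ) < (n' : ℝ) - 2 * N := by
    have : ((2 * N : ℕ) : ℝ) < n' := by exact_mod_cast (by omega : 2 * N < n')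
    push_cast at this; linarith
  have hNR : (0 : ℝ) ≤ N * δ := by positivity
  -- With m = n' - N, this κ is the mean demanded by the growth theorem. The shifts by 2N and Nd use
  -- up part of the separation 2δ, and δ remains because δn' ≥ 2Nd + dS.
  obtain ⟨r, hr0, hr1, hsaddle⟩ := hp.exists_saddle (κ := ((k' : ℝ) - N * d) / (n' - 2 * N)) hδ0
    (by linarith) hρ (by rw [le_div_iff₀ hm2]; linarith) (by rw [div_le_iff₀ hm2]; linarith)
  have hrpos : 0 < r := hρ0.trans_le hr0
  have hP := hp.massAt_pos hrpos
  have hPA : PolyAdic.massAt p r ≤ A := PolyAdic.IsGenerating.massAt_le hρ0 hρ1 hrpos.le hr1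
  have hprob := hp.isProb_tilt hρ0 hρ1 hr0 hr1
  have hmean : (((n' - N : ℕ) : ℝ) - N) *
      ∑ i ∈ Finset.range (d + 1), (PolyAdic.tilt p r).coeff i * i = k' - N * d := by
    have e : ∑ i ∈ Finset.range (d + 1), (PolyAdic.tilt p r).coeff i * i
        = ((k' : ℝ) - N * d) / (n' - 2 * N) := by
      simp only [PolyAdic.coeff_tilt, mul_assoc]
      simp only [mul_assoc] at hsaddle
      rw [← Finset.mul_sum, hsaddle, mul_comm, mul_assoc, mul_inv_cancel₀ hP.ne', mul_one]
    rw [e, Nat.cast_sub (by omega)]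
    rw [show (n' : ℝ) - N - N = n' - 2 * N by ring]
    exact mul_div_cancel₀ _ hm2.ne'
  set W := r ^ k' * ((PolyAdic.massAt p r)⁻¹) ^ (n' - N) with hW
  have habs : ∀ s t : ℕ, s + N ≤ n' →
      |(PolyAdic.tiltWeight (N * d) α R r * PolyAdic.tilt p r ^ (n' - N - s)).coeff (k' - t)|
      = r ^ (k' - t) * ((PolyAdic.massAt p r)⁻¹) ^ (n' - N - s) *
        |PolyAdic.gam p N α R (n' - s) (k' - t)| := by
    intro s t hs
    have := PolyAdic.coeff_tiltWeight_mul_tilt_pow p N α R r (n' - s) (k' - t)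
    rw [show n' - s - N = n' - N - s by omega] at this
    rw [this, abs_mul, abs_of_nonneg (by positivity)]
  have hgrowth := hcore (n' - N) k' (PolyAdic.tilt p r) (PolyAdic.tiltWeight (N * d) α R r)
    (W * M) (by omega) hprob hmean (PolyAdic.natDegree_tiltWeight_le _ _ _ _) ?_
  · obtain ⟨⟨hNn, hnn'⟩, hkk', hnk, hcone⟩ := hbelow
    have ht : k' - k ≤ d * (n' - n) := by
      have h1 : ((n' - n : ℕ) : ℤ) = n' - n := by omega
      have h2 : ((k' - k : ℕ) : ℤ) = k' - k := by omega
      have : ((k' - k : ℕ) : ℤ) ≤ d * (n' - n : ℕ) := by rw [h1, h2]; linarith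
      exact_mod_cast this
    have h := hgrowth (n' - n) (by omega) (k' - k) ht (by omega)
    rw [habs _ _ (by omega)] at h
    have hx := PolyAdic.le_mul_inv_pow_of_tilted_le hrpos hP hρ0 hb2 (by linarith) hK.le hM0
      (by omega) (by omega) (hp.pow_mul_one_add_pow_le hρ0 hr0 hr1 ht) h
    rw [show n' - (n' - n) = n by omega, show k' - (k' - k) = k by omega] at hx
    have := hrate (n' - n) _ (hbound n k ⟨⟨hNn, hnn'⟩, hkk', hnk, hcone⟩) hx
    rwa [Nat.cast_sub hnn'] at this
  · intro s hs t ht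
    have htS : t ≤ d * S := ht.trans (Nat.mul_le_mul le_rfl hs)
    rw [habs s t (by omega)]
    exact PolyAdic.tilted_le_of_le hP hρ0 hρ1 hr0 hPA hA1 (by omega) (by omega) hs ht
      (hbound _ _ (PolyAdic.isBelow_sub_sub (by omega) hkS hkS' hs ht))
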